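/- Let $(\gamma_{i,j})_{i,j\ge 1}$ be real numbers with $0\le\gamma_{i,j}=\gamma_{j,i}$ for all $i,j\ge1$, and let $\xi^{in}=(\xi^{in}_i)_{i\ge1}$ be a sequence of non-negative real numbers with $\sum_{i\ge1} i\,\xi_i^{in}<\infty$. Consider the discrete Safronov--Dubovski\v{\i} coagulation equation $$\frac{d\xi_i}{dt}=\xi_{i-1}\sum_{j=1}^{i-1}j\gamma_{i-1,j}\xi_j-\xi_i\sum_{j=1}^{i}j\gamma_{i,j}\xi_j-\sum_{j=i}^{\infty}\gamma_{i,j}\xi_i\xi_j,\qquad \xi_i(0)=\xi_i^{in},\qquad i\ge1,$$ where the first term is $0$ for $i=1$. A solution on $[0,\infty)$ is a sequence $\xi=(\xi_i)_{i\ge1}$ of non-negative continuous functions on $[0,\infty)$ such that, for every $i\ge1$ and $t>0$, $\sum_{j=i}^\infty\gamma_{i,j}\xi_i\xi_j\in L^1(0,t)$ and $$\xi_i(t)=\xi_i^{in}+\int_0^t\Big[\xi_{i-1}(s)\sum_{j=1}^{i-1}j\gamma_{i-1,j}\xi_j(s)-\xi_i(s)\sum_{j=1}^{i}j\gamma_{i,j}\xi_j(s)-\sum_{j=i}^{\infty}\gamma_{i,j}\xi_i(s)\xi_j(s)\Big]ds.$$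 Suppose that there are $\delta\in[0,1]$ and $A>0$ such that $$\sum_{i=1}^\infty i^{1+\delta}\xi_i^{in}<\infty\qquad\text{and}\qquad \gamma_{i,j}\le A(i^\delta+j^\delta)\quad\text{for all } i,j\ge1.$$ Then there is one and only one solution $\xi$ on $[0,\infty)$ which satisfies $$\sum_{i=1}^\infty i\,\xi_i(t)=\sum_{i=1}^\infty i\,\xi_i^{in}\quad\text{for all } t\ge0$$ and, for each $T\in(0,\infty)$, $$\sup_{t\in[0,T]}\sum_{i=1}^\infty i^{1+\delta}\xi_i(t)<\infty.$$ -/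

import Mathlib

open MeasureTheory Set

namespace SafronovDubovskii

/- Sequences indexed by the cluster sizes `i = 1, 2, 3, …` are functions `x : ℕ → ℝ` of which only
the values at indices `≥ 1` are ever used; a series over `i ≥ 1` is written with `i = k + 1`, a series
over `j ≥ i` with `j = i + k`, where `k : ℕ`. -/

/-- The sequence `x` lies in the weighted space `Ξ_m`: the series `∑_{i ≥ 1} i ^ m * |x i|` converges. -/
def MemXi (m : ℝ) (x : ℕ → ℝ) : Prop :=
  Summable fun k : ℕ => ((k + 1 : ℕ) : ℝ) ^ m * |x (k + 1)|

/-- The norm `∑_{i ≥ 1} i ^ m * |x i|` of `Ξ_m`. -/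
noncomputable def xiNorm (m : ℝ) (x : ℕ → ℝ) : ℝ :=
  ∑' k : ℕ, ((k + 1 : ℕ) : ℝ) ^ m * |x (k + 1)|

/-- The positive cone of `Ξ_m`. -/
def MemXiPos (m : ℝ) (x : ℕ → ℝ) : Prop :=
  MemXi m x ∧ ∀ i : ℕ, 1 ≤ i → 0 ≤ x i

/-- The series defining the moment of order `m` of `x` converges. -/
def HasMoment (m : ℝ) (x : ℕ → ℝ) : Prop :=
  Summable fun k : ℕ => ((k + 1 : ℕ) : ℝ) ^ m * x (k + 1)

/-- The moment `∑_{i ≥ 1} i ^ m * x i` of order `m`. -/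
noncomputable def moment (m : ℝ) (x : ℕ → ℝ) : ℝ :=
  ∑' k : ℕ, ((k + 1 : ℕ) : ℝ) ^ m * x (k + 1)

/-- The term `∑_{j ≥ i} γ i j * x i * x j`. -/
noncomputable def tailLoss (γ : ℕ → ℕ → ℝ) (x : ℕ → ℝ) (i : ℕ) : ℝ :=
  ∑' k : ℕ, γ i (i + k) * x i * x (i + k)

/-- The right-hand side of the discrete Safronov–Dubovskii equation for the size `i ≥ 1`. For `i = 1`
the first sum is empty. -/
noncomputable def rhs (γ : ℕ → ℕ → ℝ) (x : ℕ → ℝ) (i : ℕ) : ℝ :=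
  x (i - 1) * ∑ j ∈ Finset.Icc 1 (i - 1), (j : ℝ) * γ (i - 1) j * x j
    - x i * ∑ j ∈ Finset.Icc 1 i, (j : ℝ) * γ i j * x j
    - tailLoss γ x i

/-- `ξ` (with `ξ t i` the concentration of `i`-clusters at time `t`) is a solution on `[0, T)`,
`T ∈ (0, ∞]`, of the discrete Safronov–Dubovskii equation with kernel `γ` and initial datum `xin`.
The field `tail_integrable` says that `∑_{j ≥ i} γ i j * ξ i * ξ j` is in `L¹(0, t)`; in particular the
series has a finite sum at almost every time. -/
structure IsSolution (γ : ℕ → ℕ → ℝ) (xin : ℕ → ℝ) (T : EReal) (ξ : ℝ → ℕ → ℝ) : Prop where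
  nonneg : ∀ i : ℕ, 1 ≤ i → ∀ t : ℝ, 0 ≤ t → (t : EReal) < T → 0 ≤ ξ t i
  continuousOn : ∀ i : ℕ, 1 ≤ i →
    ContinuousOn (fun t => ξ t i) {t : ℝ | 0 ≤ t ∧ (t : EReal) < T}
  tail_summable : ∀ i : ℕ, 1 ≤ i → ∀ t : ℝ, 0 < t → (t : EReal) < T →
    ∀ᵐ s ∂(volume.restrict (Ioo 0 t)), Summable fun k : ℕ => γ i (i + k) * ξ s i * ξ s (i + k)
  tail_integrable : ∀ i : ℕ, 1 ≤ i → ∀ t : ℝ, 0 < t → (t : EReal) < T →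
    IntegrableOn (fun s => tailLoss γ (ξ s) i) (Ioo 0 t) volume
  equation : ∀ i : ℕ, 1 ≤ i → ∀ t : ℝ, 0 < t → (t : EReal) < T →
    ξ t i = xin i + ∫ s in (0 : ℝ)..t, rhs γ (ξ s) i

/-- Mass conservation on `[0, ∞)`: `ξ t` lies in `Ξ_1` and `‖ξ t‖_1 = ‖xin‖_1` for all `t ≥ 0`. -/
def MassConserving (xin : ℕ → ℝ) (ξ : ℝ → ℕ → ℝ) : Prop :=
  ∀ t : ℝ, 0 ≤ t → MemXi 1 (ξ t) ∧ xiNorm 1 (ξ t) = xiNorm 1 xin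

/-- The moment of order `m` of `ξ` is finite on `[0, ∞)` and bounded on every `[0, T]`. -/
def LocallyBoundedMoment (m : ℝ) (ξ : ℝ → ℕ → ℝ) : Prop :=
  ∀ T : ℝ, 0 < T → (∀ t ∈ Icc 0 T, HasMoment m (ξ t)) ∧
    BddAbove ((fun t => moment m (ξ t)) '' Icc 0 T)

end SafronovDubovskii

/-! With `F i = x i * ∑_{j ≤ i} j * γ i j * x j` (`flux`), the equation reads `x_i' = F (i - 1) - F
i - x i * ∑_{j ≥ i} γ i j * x j`. Everything rests on one quantity, the moment `∑ i * w i * x i`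
with `w i = i ^ δ`. A bound `K` on it forces `∑_{j ≥ m} w j * x j ≤ K / m`, so the infinite loss
sums converge uniformly over controlled sequences.

Existence: with the kernel cut off at size `N` the system is finite, conserves mass exactly, and by
summation by parts its weighted moment grows at most exponentially, at a rate independent of `N`
(`exists_regular_trunc`). Uniform Lipschitz bounds in time yield a pointwise convergent subsequence,
and the small tails let the integrated equation pass to the limit (`exists_isSolution`). The limit
conserves mass because the mass leaving the sizes `≤ n` is at most a multiple of `n * w n * x n`
plus `O(1 / n)`, which tends to zero (`IsRegularOn.tsum_eq`).

Uniqueness: consider `∑_{i ≤ n} i * |x i - y i|` for two solutions. The growth terms telescope up to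
a boundary term of favourable sign, and the derivative is at most `10 * A * K * D` whenever `D`
bounds these sums for all `n` (`sum_abs_deriv_le`). Iterating from `D = 2 * K` gives the bounds `2 *
K * (10 * A * K * t) ^ k / k!`, which tend to zero (`IsRegularOn.eq_of_controlled`). -/

namespace SafronovDubovskii

/-! ### Weights, kernels and controlled sequences -/

/-- Admissible weights: the abstract properties of `i ↦ i ^ δ`, `δ ∈ [0, 1]`, used below. -/
structure IsWeight (w : ℕ → ℝ) : Prop where
  one_le : ∀ i : ℕ, 1 ≤ i → 1 ≤ w i
  le_self : ∀ i : ℕ, 1 ≤ i → w i ≤ i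
  mono : ∀ i j : ℕ, 1 ≤ i → i ≤ j → w i ≤ w j
  succ_le : ∀ i : ℕ, 1 ≤ i → ((i : ℝ) + 1) * w (i + 1) ≤ i * w i + 3 * w i

/-- A non-negative symmetric kernel with `γ i j ≤ A * (w i + w j)`. -/
structure IsKernel (A : ℝ) (w : ℕ → ℝ) (γ : ℕ → ℕ → ℝ) : Prop where
  const_pos : 0 < A
  nonneg : ∀ i j : ℕ, 1 ≤ i → 1 ≤ j → 0 ≤ γ i j
  symm : ∀ i j : ℕ, 1 ≤ i → 1 ≤ j → γ i j = γ j i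
  le : ∀ i j : ℕ, 1 ≤ i → 1 ≤ j → γ i j ≤ A * (w i + w j)

/-- A non-negative sequence with `∑ i * w i * x i ≤ K`. -/
structure Controlled (w : ℕ → ℝ) (K : ℝ) (x : ℕ → ℝ) : Prop where
  nonneg : ∀ i : ℕ, 1 ≤ i → 0 ≤ x i
  sum_le : ∀ n : ℕ, ∑ i ∈ Finset.Icc 1 n, (i : ℝ) * w i * x i ≤ K

/-- The rate `x i * ∑_{j ≤ i} j * γ i j * x j` at which `i`-clusters grow. -/
noncomputable def flux (γ : ℕ → ℕ → ℝ) (x : ℕ → ℝ) (i : ℕ) : ℝ :=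
  x i * ∑ j ∈ Finset.Icc 1 i, (j : ℝ) * γ i j * x j

/-- The series `∑_{j ≥ i} γ i j * x j`. -/
noncomputable def tailSum (γ : ℕ → ℕ → ℝ) (x : ℕ → ℝ) (i : ℕ) : ℝ :=
  ∑' k : ℕ, γ i (i + k) * x (i + k)

/-- The growth condition is Bernoulli's inequality: `(1 + 1 / i) ^ δ ≤ 1 + 1 / i`, and `(i + 1) * (1
+ 1 / i) = i + 2 + 1 / i ≤ i + 3`. -/
theorem isWeight_rpow {δ : ℝ} (hδ : δ ∈ Icc (0 : ℝ) 1) : IsWeight fun i => (i : ℝ) ^ δ where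
  one_le i hi := Real.one_le_rpow (by exact_mod_cast hi) hδ.1
  le_self i hi := by
    simpa using Real.rpow_le_rpow_of_exponent_le (by exact_mod_cast hi : (1 : ℝ) ≤ i) hδ.2
  mono i j hi hij := Real.rpow_le_rpow (by positivity) (by exact_mod_cast hij) hδ.1
  succ_le i hi := by
    have hi1 : (1 : ℝ) ≤ i := by exact_mod_cast hi
    have hpos : (0 : ℝ) < i := by linarith
    have hinv : (1 : ℝ) / i ≤ 1 := by rw [div_le_one hpos]; exact hi1
    have hb : (1 + 1 / (i : ℝ)) ^ δ ≤ 1 + 1 / i := by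
      refine (rpow_one_add_le_one_add_mul_self ?_ hδ.1 hδ.2).trans ?_
      · have : (0 : ℝ) ≤ 1 / i := by positivity
        linarith
      · have : δ * (1 / (i : ℝ)) ≤ 1 * (1 / i) :=
          mul_le_mul_of_nonneg_right hδ.2 (by positivity)
        linarith
    have hs : (((i + 1 : ℕ) : ℝ)) ^ δ = (i : ℝ) ^ δ * (1 + 1 / (i : ℝ)) ^ δ := by
      rw [← Real.mul_rpow hpos.le (by positivity)]
      congr 1
      push_cast
      field_simp
    have hw : 0 ≤ (i : ℝ) ^ δ := by positivity
    calc ((i : ℝ) + 1) * ((i + 1 : ℕ) : ℝ) ^ δ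
        ≤ ((i : ℝ) + 1) * ((i : ℝ) ^ δ * (1 + 1 / i)) := by rw [hs]; gcongr
      _ = (i + 2 + 1 / i) * (i : ℝ) ^ δ := by field_simp; ring
      _ ≤ (i + 3) * (i : ℝ) ^ δ := by gcongr ?_ * _; linarith
      _ = _ := by ring

namespace IsKernel

variable {A : ℝ} {w : ℕ → ℝ} {γ : ℕ → ℕ → ℝ}

theorem le_left (hγ : IsKernel A w γ) (hw : IsWeight w) {i j : ℕ} (hj : 1 ≤ j) (hji : j ≤ i) :
    γ i j ≤ 2 * A * w i := by
  have h1 := hγ.le i j (hj.trans hji) hj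
  have h2 := mul_le_mul_of_nonneg_left (hw.mono j i hj hji) hγ.const_pos.le
  linarith

theorem le_right (hγ : IsKernel A w γ) (hw : IsWeight w) {i j : ℕ} (hi : 1 ≤ i) (hij : i ≤ j) :
    γ i j ≤ 2 * A * w j := by
  rw [hγ.symm i j hi (hi.trans hij)]
  exact hγ.le_left hw hi hij

end IsKernel

namespace Controlled

variable {w : ℕ → ℝ} {K : ℝ} {x : ℕ → ℝ}

theorem term_nonneg (h : Controlled w K x) (hw : IsWeight w) {i : ℕ} (hi : 1 ≤ i) :
    0 ≤ (i : ℝ) * w i * x i :=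
  mul_nonneg (mul_nonneg (by positivity) (zero_le_one.trans (hw.one_le i hi))) (h.nonneg i hi)

theorem const_nonneg (h : Controlled w K x) : 0 ≤ K := by
  simpa using h.sum_le 0

theorem term_le (h : Controlled w K x) (hw : IsWeight w) {i : ℕ} (hi : 1 ≤ i) :
    (i : ℝ) * w i * x i ≤ K :=
  (Finset.single_le_sum (f := fun i : ℕ => (i : ℝ) * w i * x i)
    (fun _ hj => h.term_nonneg hw (Finset.mem_Icc.1 hj).1)
    (Finset.mem_Icc.2 ⟨hi, le_rfl⟩)).trans (h.sum_le i)

theorem apply_le (h : Controlled w K x) (hw : IsWeight w) {i : ℕ} (hi : 1 ≤ i) : x i ≤ K := by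
  have h1 : (1 : ℝ) ≤ i * w i :=
    one_le_mul_of_one_le_of_one_le (by exact_mod_cast hi) (hw.one_le i hi)
  exact (le_mul_of_one_le_left (h.nonneg i hi) h1).trans (h.term_le hw hi)

theorem sum_mul_le (h : Controlled w K x) (hw : IsWeight w) (n : ℕ) :
    ∑ i ∈ Finset.Icc 1 n, (i : ℝ) * x i ≤ K := by
  refine (Finset.sum_le_sum fun i hi => ?_).trans (h.sum_le n)
  have hi1 := (Finset.mem_Icc.1 hi).1
  exact mul_le_mul_of_nonneg_right
    (le_mul_of_one_le_right (by positivity) (hw.one_le i hi1)) (h.nonneg i hi1)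

/-- Tails of `∑ w j * x j` decay like the inverse of the cut-off. -/
theorem sum_Ico_le (h : Controlled w K x) (hw : IsWeight w) {m : ℕ} (hm : 1 ≤ m) (n : ℕ) :
    ∑ j ∈ Finset.Ico m n, w j * x j ≤ K / m := by
  have hm0 : (0 : ℝ) < m := by exact_mod_cast hm
  rw [le_div_iff₀ hm0, Finset.sum_mul]
  calc ∑ j ∈ Finset.Ico m n, w j * x j * m
      ≤ ∑ j ∈ Finset.Ico m n, (j : ℝ) * w j * x j := by
        refine Finset.sum_le_sum fun j hj => ?_
        obtain ⟨hj1, -⟩ := Finset.mem_Ico.1 hj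
        have hj2 : (m : ℝ) ≤ j := by exact_mod_cast hj1
        have : 0 ≤ w j * x j := mul_nonneg (zero_le_one.trans (hw.one_le j (hm.trans hj1)))
          (h.nonneg j (hm.trans hj1))
        nlinarith
    _ ≤ ∑ j ∈ Finset.Icc 1 n, (j : ℝ) * w j * x j := by
        refine Finset.sum_le_sum_of_subset_of_nonneg (fun j hj => ?_) fun j hj _ =>
          h.term_nonneg hw (Finset.mem_Icc.1 hj).1
        obtain ⟨hj1, hj2⟩ := Finset.mem_Ico.1 hj
        exact Finset.mem_Icc.2 ⟨hm.trans hj1, hj2.le⟩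
    _ ≤ K := h.sum_le n

end Controlled

/-! ### Bounds on the gain and loss terms -/

section Estimates

variable {A : ℝ} {w : ℕ → ℝ} {γ : ℕ → ℕ → ℝ} {K : ℝ} {x : ℕ → ℝ}

theorem tailLoss_eq (γ : ℕ → ℕ → ℝ) (x : ℕ → ℝ) (i : ℕ) :
    tailLoss γ x i = x i * tailSum γ x i := by
  rw [tailLoss, tailSum, ← tsum_mul_left]
  exact tsum_congr fun k => by ring

@[simp]
theorem flux_zero (γ : ℕ → ℕ → ℝ) (x : ℕ → ℝ) : flux γ x 0 = 0 := by
  simp [flux]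

theorem rhs_eq (γ : ℕ → ℕ → ℝ) (x : ℕ → ℝ) (i : ℕ) :
    rhs γ x i = flux γ x (i - 1) - flux γ x i - x i * tailSum γ x i := by
  rw [rhs, tailLoss_eq, flux, flux]

theorem gain_sum_nonneg (hγ : IsKernel A w γ) (hx : ∀ i : ℕ, 1 ≤ i → 0 ≤ x i) (i : ℕ) :
    0 ≤ ∑ j ∈ Finset.Icc 1 i, (j : ℝ) * γ i j * x j :=
  Finset.sum_nonneg fun j hj => by
    obtain ⟨h1, h2⟩ := Finset.mem_Icc.1 hj
    exact mul_nonneg (mul_nonneg (by positivity) (hγ.nonneg i j (h1.trans h2) h1)) (hx j h1)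

/-- For `j ≤ i` the kernel is at most `2 * A * w i`, and what remains is the mass. Only `M` enters,
not the weighted moment, which keeps the moment inequality linear. Uniqueness applies this to `|x -
y|` as well. -/
theorem gain_sum_le (hγ : IsKernel A w γ) (hw : IsWeight w) (hx : ∀ i : ℕ, 1 ≤ i → 0 ≤ x i)
    {M : ℝ} (hM : ∀ n : ℕ, ∑ j ∈ Finset.Icc 1 n, (j : ℝ) * x j ≤ M) {i : ℕ} (hi : 1 ≤ i) :
    ∑ j ∈ Finset.Icc 1 i, (j : ℝ) * γ i j * x j ≤ 2 * A * w i * M := by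
  have hc : 0 ≤ 2 * A * w i :=
    mul_nonneg (by linarith [hγ.const_pos]) (zero_le_one.trans (hw.one_le i hi))
  refine le_trans ?_ (mul_le_mul_of_nonneg_left (hM i) hc)
  rw [Finset.mul_sum]
  refine Finset.sum_le_sum fun j hj => ?_
  obtain ⟨h1, h2⟩ := Finset.mem_Icc.1 hj
  have := mul_le_mul_of_nonneg_left (hγ.le_left hw h1 h2)
    (mul_nonneg (Nat.cast_nonneg (α := ℝ) j) (hx j h1))
  linarith

theorem flux_nonneg (hγ : IsKernel A w γ) (hx : ∀ i : ℕ, 1 ≤ i → 0 ≤ x i) (i : ℕ) :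
    0 ≤ flux γ x i := by
  rcases Nat.eq_zero_or_pos i with rfl | hi
  · simp
  · exact mul_nonneg (hx i hi) (gain_sum_nonneg hγ hx i)

theorem flux_le (hγ : IsKernel A w γ) (hw : IsWeight w) (hx : ∀ i : ℕ, 1 ≤ i → 0 ≤ x i)
    {M : ℝ} (hM : ∀ n : ℕ, ∑ j ∈ Finset.Icc 1 n, (j : ℝ) * x j ≤ M) {i : ℕ} (hi : 1 ≤ i) :
    flux γ x i ≤ 2 * A * M * (w i * x i) := by
  have := mul_le_mul_of_nonneg_left (gain_sum_le hγ hw hx hM hi) (hx i hi)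
  rw [flux]
  linarith

theorem tail_term_nonneg (hγ : IsKernel A w γ) (hx : ∀ i : ℕ, 1 ≤ i → 0 ≤ x i) {i : ℕ}
    (hi : 1 ≤ i) (k : ℕ) : 0 ≤ γ i (i + k) * x (i + k) :=
  mul_nonneg (hγ.nonneg _ _ hi (by lia)) (hx _ (by lia))

/-- Finite pieces of the tail series are small, uniformly over controlled sequences. -/
theorem sum_Ico_tail_le (hγ : IsKernel A w γ) (hw : IsWeight w) (hx : Controlled w K x) {i : ℕ}
    (hi : 1 ≤ i) (m n : ℕ) :
    ∑ k ∈ Finset.Ico m n, γ i (i + k) * x (i + k) ≤ 2 * A * K / (i + m : ℕ) := by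
  have hA := hγ.const_pos
  calc ∑ k ∈ Finset.Ico m n, γ i (i + k) * x (i + k)
      ≤ ∑ k ∈ Finset.Ico m n, 2 * A * (w (i + k) * x (i + k)) := by
        refine Finset.sum_le_sum fun k _ => ?_
        rw [← mul_assoc]
        exact mul_le_mul_of_nonneg_right (hγ.le_right hw hi (by lia)) (hx.nonneg _ (by lia))
    _ = 2 * A * ∑ j ∈ Finset.Ico (i + m) (i + n), w j * x j := by
        rw [← Finset.mul_sum, Finset.sum_Ico_add (fun j => w j * x j) m n i, add_comm m, add_comm n]
    _ ≤ 2 * A * (K / (i + m : ℕ)) := by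
        gcongr
        exact hx.sum_Ico_le hw (by lia) _
    _ = _ := by ring

theorem summable_tail (hγ : IsKernel A w γ) (hw : IsWeight w) (hx : Controlled w K x) {i : ℕ}
    (hi : 1 ≤ i) : Summable fun k : ℕ => γ i (i + k) * x (i + k) :=
  summable_of_sum_range_le (tail_term_nonneg hγ hx.nonneg hi) fun n => by
    simpa using sum_Ico_tail_le hγ hw hx hi 0 n

theorem tailSum_nonneg (hγ : IsKernel A w γ) (hx : ∀ i : ℕ, 1 ≤ i → 0 ≤ x i) {i : ℕ}
    (hi : 1 ≤ i) : 0 ≤ tailSum γ x i :=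
  tsum_nonneg (tail_term_nonneg hγ hx hi)

theorem sum_range_le_tailSum (hγ : IsKernel A w γ) (hw : IsWeight w) (hx : Controlled w K x)
    {i : ℕ} (hi : 1 ≤ i) (m : ℕ) :
    ∑ k ∈ Finset.range m, γ i (i + k) * x (i + k) ≤ tailSum γ x i :=
  (summable_tail hγ hw hx hi).sum_le_tsum _ fun k _ => tail_term_nonneg hγ hx.nonneg hi k

/-- Together with `sum_range_le_tailSum` this replaces the infinite sum by a finite one with an
error uniform over controlled sequences; continuity and the passage to the limit rely on it. -/
theorem tailSum_le (hγ : IsKernel A w γ) (hw : IsWeight w) (hx : Controlled w K x) {i : ℕ}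
    (hi : 1 ≤ i) (m : ℕ) :
    tailSum γ x i ≤
      ∑ k ∈ Finset.range m, γ i (i + k) * x (i + k) + 2 * A * K / (i + m : ℕ) := by
  refine le_of_tendsto' (summable_tail hγ hw hx hi).hasSum.tendsto_sum_nat fun n => ?_
  rcases le_total m n with h | h
  · rw [← Finset.sum_range_add_sum_Ico _ h]
    gcongr
    exact sum_Ico_tail_le hγ hw hx hi m n
  · have h0 : 0 ≤ 2 * A * K / (i + m : ℕ) :=
      div_nonneg (mul_nonneg (by linarith [hγ.const_pos]) hx.const_nonneg) (by positivity)
    have := Finset.sum_le_sum_of_subset_of_nonneg (Finset.range_subset_range.2 h)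
      (f := fun k => γ i (i + k) * x (i + k)) fun k _ _ => tail_term_nonneg hγ hx.nonneg hi k
    linarith

theorem summable_tailLoss (hγ : IsKernel A w γ) (hw : IsWeight w) (hx : Controlled w K x) {i : ℕ}
    (hi : 1 ≤ i) : Summable fun k : ℕ => γ i (i + k) * x i * x (i + k) :=
  ((summable_tail hγ hw hx hi).mul_left (x i)).congr fun k => by ring

/-- `|x_i'|` is bounded in terms of the control constant. -/
theorem abs_rhs_le (hγ : IsKernel A w γ) (hw : IsWeight w) (hx : Controlled w K x) {i : ℕ}
    (hi : 1 ≤ i) : |rhs γ x i| ≤ 2 * A * K * K * 2 := by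
  have hA := hγ.const_pos
  have hK := hx.const_nonneg
  have hflux : ∀ j : ℕ, flux γ x j ≤ 2 * A * K * K := fun j => by
    rcases Nat.eq_zero_or_pos j with rfl | hj
    · rw [flux_zero]; positivity
    · refine (flux_le hγ hw hx.nonneg (hx.sum_mul_le hw) hj).trans ?_
      gcongr
      refine le_trans ?_ (hx.term_le hw hj)
      rw [mul_assoc]
      exact le_mul_of_one_le_left (mul_nonneg (zero_le_one.trans (hw.one_le j hj))
        (hx.nonneg j hj)) (by exact_mod_cast hj)
  have ht : x i * tailSum γ x i ≤ 2 * A * K * K := by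
    have h1 : tailSum γ x i ≤ 2 * A * K := by
      refine (tailSum_le hγ hw hx hi 0).trans ?_
      simp only [Finset.range_zero, Finset.sum_empty, zero_add, add_zero]
      exact div_le_self (by positivity) (by exact_mod_cast hi)
    calc x i * tailSum γ x i ≤ K * (2 * A * K) :=
          mul_le_mul (hx.apply_le hw hi) h1 (tailSum_nonneg hγ hx.nonneg hi) hK
      _ = _ := by ring
  have ht0 := mul_nonneg (hx.nonneg i hi) (tailSum_nonneg hγ hx.nonneg hi)
  rw [rhs_eq, abs_le]
  have h1 := hflux (i - 1)
  have h2 := hflux i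
  have h3 := flux_nonneg hγ hx.nonneg (i - 1)
  have h4 := flux_nonneg hγ hx.nonneg i
  constructor <;> linarith

end Estimates

/-! ### Summation by parts and the mass balance -/

theorem sum_mul_sub_pred (g F : ℕ → ℝ) (hF : F 0 = 0) (n : ℕ) :
    ∑ i ∈ Finset.Icc 1 n, g i * (F (i - 1) - F i) =
      ∑ i ∈ Finset.Icc 1 n, (g (i + 1) - g i) * F i - g (n + 1) * F n := by
  induction n with
  | zero => simp [hF]
  | succ n ih =>
    rw [Finset.sum_Icc_succ_top (by lia), Finset.sum_Icc_succ_top (by lia), ih,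
      Nat.add_sub_cancel]
    ring

/-- Interchange the sums over `1 ≤ j ≤ i ≤ n` and use the symmetry of the kernel: mass gained by
growing clusters is mass lost by the smaller partners. The range `n + 1 - i` enumerates the partners
of sizes `i, …, n`. -/
theorem sum_flux_eq {A : ℝ} {w : ℕ → ℝ} {γ : ℕ → ℕ → ℝ} (hγ : IsKernel A w γ) (x : ℕ → ℝ)
    (n : ℕ) :
    ∑ i ∈ Finset.Icc 1 n, flux γ x i = ∑ i ∈ Finset.Icc 1 n,
      (i : ℝ) * (x i * ∑ k ∈ Finset.range (n + 1 - i), γ i (i + k) * x (i + k)) := by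
  have h1 : ∀ i ∈ Finset.Icc 1 n, (i : ℝ) * (x i * ∑ k ∈ Finset.range (n + 1 - i),
      γ i (i + k) * x (i + k)) = ∑ j ∈ Finset.Icc i n, (i : ℝ) * (x i * (γ i j * x j)) := by
    intro i _
    rw [Finset.mul_sum, Finset.mul_sum, Finset.range_eq_Ico,
      Finset.sum_Ico_add (fun j => (i : ℝ) * (x i * (γ i j * x j))) 0 (n + 1 - i) i]
    refine Finset.sum_congr ?_ fun _ _ => rfl
    ext j
    simp only [Finset.mem_Ico, Finset.mem_Icc]
    lia
  rw [Finset.sum_congr rfl h1]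
  simp only [flux, Finset.mul_sum]
  rw [Finset.sum_comm' (t' := Finset.Icc 1 n) (s' := fun j => Finset.Icc j n)]
  · refine Finset.sum_congr rfl fun j hj => Finset.sum_congr rfl fun i hi => ?_
    obtain ⟨hj1, -⟩ := Finset.mem_Icc.1 hj
    obtain ⟨hi1, -⟩ := Finset.mem_Icc.1 hi
    rw [hγ.symm i j (hj1.trans hi1) hj1]
    ring
  · intro i j
    simp only [Finset.mem_Icc]
    lia

/-- The mass balance of the first `n` sizes. -/
theorem sum_mul_rhs {A : ℝ} {w : ℕ → ℝ} {γ : ℕ → ℕ → ℝ} (hγ : IsKernel A w γ) (x : ℕ → ℝ)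
    (n : ℕ) :
    ∑ i ∈ Finset.Icc 1 n, (i : ℝ) * rhs γ x i = -(((n : ℝ) + 1) * flux γ x n) -
      ∑ i ∈ Finset.Icc 1 n, (i : ℝ) * (x i * (tailSum γ x i -
        ∑ k ∈ Finset.range (n + 1 - i), γ i (i + k) * x (i + k))) := by
  have h := sum_mul_sub_pred (fun i => (i : ℝ)) (flux γ x) (flux_zero γ x) n
  have h' := sum_flux_eq hγ x n
  simp only [Nat.cast_add, Nat.cast_one, add_sub_cancel_left, one_mul] at h
  simp only [rhs_eq, mul_sub (_ : ℝ) (_ - _ : ℝ), mul_sub (x _), Finset.sum_sub_distrib, h, h',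
    mul_sub (_ : ℝ) (x _ * _)]
  ring

/-! ### Continuity in time and the classical form of the equation -/

open Filter Topology

section Continuity

variable {A : ℝ} {w : ℕ → ℝ} {γ : ℕ → ℕ → ℝ} {K : ℝ}

theorem tendsto_const_div_add (C : ℝ) (i : ℕ) :
    Tendsto (fun m : ℕ => C / ((i + m : ℕ) : ℝ)) atTop (𝓝 0) :=
  tendsto_const_nhds.div_atTop
    (tendsto_natCast_atTop_atTop.comp (tendsto_atTop_mono (fun m => Nat.le_add_left m i) tendsto_id))

theorem continuousOn_flux {s : Set ℝ} {ξ : ℝ → ℕ → ℝ}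
    (hc : ∀ i : ℕ, 1 ≤ i → ContinuousOn (fun t => ξ t i) s) (i : ℕ) :
    ContinuousOn (fun t => flux γ (ξ t) i) s := by
  rcases Nat.eq_zero_or_pos i with rfl | hi
  · simpa using continuousOn_const
  · exact (hc i hi).mul (continuousOn_finsetSum _ fun j hj =>
      continuousOn_const.mul (hc j (Finset.mem_Icc.1 hj).1))

theorem continuousOn_tailSum (hγ : IsKernel A w γ) (hw : IsWeight w) {s : Set ℝ}
    {ξ : ℝ → ℕ → ℝ} (hc : ∀ i : ℕ, 1 ≤ i → ContinuousOn (fun t => ξ t i) s)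
    (hK : ∀ t ∈ s, Controlled w K (ξ t)) {i : ℕ} (hi : 1 ≤ i) :
    ContinuousOn (fun t => tailSum γ (ξ t) i) s := by
  have hu : TendstoUniformlyOn
      (fun (m : ℕ) t => ∑ k ∈ Finset.range m, γ i (i + k) * ξ t (i + k))
      (fun t => tailSum γ (ξ t) i) atTop s := by
    rw [Metric.tendstoUniformlyOn_iff]
    intro ε hε
    filter_upwards [(tendsto_const_div_add (2 * A * K) i).eventually (gt_mem_nhds hε)]
      with m hm t ht
    have h1 := sum_range_le_tailSum hγ hw (hK t ht) hi m
    have h2 := tailSum_le hγ hw (hK t ht) hi m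
    rw [Real.dist_eq, abs_lt]
    constructor <;> linarith
  refine hu.continuousOn (Frequently.of_forall fun m => ?_)
  exact continuousOn_finsetSum _ fun k _ => continuousOn_const.mul (hc (i + k) (by lia))

theorem continuousOn_rhs (hγ : IsKernel A w γ) (hw : IsWeight w) {s : Set ℝ}
    {ξ : ℝ → ℕ → ℝ} (hc : ∀ i : ℕ, 1 ≤ i → ContinuousOn (fun t => ξ t i) s)
    (hK : ∀ t ∈ s, Controlled w K (ξ t)) {i : ℕ} (hi : 1 ≤ i) :
    ContinuousOn (fun t => rhs γ (ξ t) i) s := by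
  simp only [rhs_eq]
  exact ((continuousOn_flux hc _).sub (continuousOn_flux hc _)).sub
    ((hc i hi).mul (continuousOn_tailSum hγ hw hc hK hi))

end Continuity

/-- `ξ` solves the differential equation on `[0, T]` in the classical sense, with derivatives from
the right. -/
structure IsRegularOn (γ : ℕ → ℕ → ℝ) (T : ℝ) (ξ : ℝ → ℕ → ℝ) : Prop where
  continuousOn : ∀ i : ℕ, 1 ≤ i → ContinuousOn (fun t => ξ t i) (Icc 0 T)
  hasDeriv : ∀ i : ℕ, 1 ≤ i → ∀ t ∈ Ico 0 T,
    HasDerivWithinAt (fun s => ξ s i) (rhs γ (ξ t) i) (Ici t) t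

/-- A continuous function which is a primitive of a continuous function on `(0, T]` has the expected
initial value and right derivatives. -/
theorem hasDeriv_of_eq_integral {f g : ℝ → ℝ} {a T : ℝ} (hT : 0 < T)
    (hf : ContinuousOn f (Icc 0 T)) (hg : ContinuousOn g (Icc 0 T))
    (h : ∀ t ∈ Ioc 0 T, f t = a + ∫ s in (0 : ℝ)..t, g s) :
    f 0 = a ∧ ∀ t ∈ Ico 0 T, HasDerivWithinAt f (g t) (Ici t) t := by
  -- Extending `g` by constants beyond `[0, T]` gives a primitive with two-sided derivatives. It
  -- agrees with `f` on `(0, T]` by hypothesis, and at `0` by continuity.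
  set G : ℝ → ℝ := IccExtend hT.le ((Icc 0 T).domRestrict g) with hG
  have hGc : Continuous G := (continuousOn_iff_continuous_domRestrict.1 hg).Icc_extend'
  have hGg : ∀ t ∈ Icc 0 T, G t = g t := fun t ht => by
    rw [hG, IccExtend_of_mem hT.le _ ht, Set.domRestrict_apply]
  set F : ℝ → ℝ := fun t => a + ∫ s in (0 : ℝ)..t, G s with hF
  have hFd : ∀ t, HasDerivAt F (G t) t := fun t =>
    (intervalIntegral.integral_hasDerivAt_right (hGc.intervalIntegrable _ _)
      (hGc.stronglyMeasurableAtFilter _ _) hGc.continuousAt).const_add a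
  have hfF : ∀ t ∈ Ioc 0 T, f t = F t := fun t ht => by
    rw [h t ht, hF]
    congr 1
    refine intervalIntegral.integral_congr fun s hs => (hGg s ?_).symm
    rw [uIcc_of_le ht.1.le] at hs
    exact ⟨hs.1, hs.2.trans ht.2⟩
  have hF0 : F 0 = a := by simp [hF]
  have hf0 : f 0 = a := by
    have h1 : Tendsto f (𝓝[>] 0) (𝓝 (f 0)) :=
      ((hf 0 ⟨le_rfl, hT.le⟩).mono_of_mem_nhdsWithin (Icc_mem_nhdsGT hT)).tendsto
    have h2 : Tendsto F (𝓝[>] 0) (𝓝 a) := by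
      rw [← hF0]
      exact (hFd 0).continuousAt.tendsto.mono_left nhdsWithin_le_nhds
    refine tendsto_nhds_unique h1 (h2.congr' ?_)
    filter_upwards [Ioc_mem_nhdsGT hT] with t ht using (hfF t ht).symm
  refine ⟨hf0, fun t ht => ?_⟩
  have hall : ∀ s ∈ Icc 0 T, f s = F s := fun s hs => by
    rcases hs.1.eq_or_lt with rfl | h0
    · rw [hf0, hF0]
    · exact hfF s ⟨h0, hs.2⟩
  rw [← hGg t (Ico_subset_Icc_self ht)]
  refine (hFd t).hasDerivWithinAt.congr_of_eventuallyEq ?_ (hall t (Ico_subset_Icc_self ht))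
  filter_upwards [Ico_mem_nhdsGE ht.2] with s hs using hall s ⟨ht.1.trans hs.1, hs.2.le⟩

/-- A uniform bound on the weighted moment makes the right-hand side continuous in time, so the
integral equation can be differentiated everywhere, not merely almost everywhere. -/
theorem IsSolution.isRegularOn {A : ℝ} {w : ℕ → ℝ} {γ : ℕ → ℕ → ℝ} {K T : ℝ} {xin : ℕ → ℝ}
    {ξ : ℝ → ℕ → ℝ} (hγ : IsKernel A w γ) (hw : IsWeight w) (hT : 0 < T)
    (h : IsSolution γ xin ⊤ ξ) (hK : ∀ t ∈ Icc 0 T, Controlled w K (ξ t)) :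
    (∀ i : ℕ, 1 ≤ i → ξ 0 i = xin i) ∧ IsRegularOn γ T ξ := by
  have hc : ∀ i : ℕ, 1 ≤ i → ContinuousOn (fun t => ξ t i) (Icc 0 T) := fun i hi =>
    (h.continuousOn i hi).mono fun t ht => ⟨ht.1, EReal.coe_lt_top t⟩
  have key := fun (i : ℕ) (hi : 1 ≤ i) => hasDeriv_of_eq_integral hT (hc i hi)
    (continuousOn_rhs hγ hw hc hK hi) fun t ht => h.equation i hi t ht.1 (EReal.coe_lt_top t)
  exact ⟨fun i hi => (key i hi).1, hc, fun i hi => (key i hi).2⟩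

/-! ### Uniqueness -/

section AbsoluteValue

/-- At a zero of `f` the absolute value still has a right derivative, namely `|f'|`; this is why
right derivatives are used. -/
theorem hasDerivWithinAt_abs_right {f : ℝ → ℝ} {f' t : ℝ} (h : HasDerivWithinAt f f' (Ici t) t) :
    HasDerivWithinAt (fun s => |f s|)
      (if f t = 0 then |f'| else (SignType.sign (f t) : ℝ) * f') (Ici t) t := by
  split_ifs with h0
  · rw [hasDerivWithinAt_iff_tendsto_slope, Ici_sdiff_left] at h ⊢
    refine h.abs.congr' ?_
    filter_upwards [self_mem_nhdsWithin] with s hs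
    have hs' : 0 < s - t := sub_pos.2 hs
    simp [slope_def_field, h0, abs_div, abs_of_pos hs']
  · exact (hasDerivAt_abs h0).comp_hasDerivWithinAt t h

/-- Preserves the damping `-p * |z|`, which a plain triangle inequality would lose. -/
theorem abs_deriv_le {z z' p b : ℝ} (h : |z' + p * z| ≤ b) :
    (if z = 0 then |z'| else (SignType.sign z : ℝ) * z') ≤ b - p * |z| := by
  split_ifs with h0
  · simpa [h0] using h
  · have hb := abs_le.1 h
    rcases lt_or_gt_of_ne h0 with hz | hz
    · rw [sign_neg hz, abs_of_neg hz]
      simp only [SignType.coe_neg, SignType.coe_one]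
      linarith [hb.1]
    · rw [sign_pos hz, abs_of_pos hz]
      simp only [SignType.coe_one]
      linarith [hb.2]

end AbsoluteValue

section Uniqueness

variable {A : ℝ} {w : ℕ → ℝ} {γ : ℕ → ℕ → ℝ} {K : ℝ} {x y : ℕ → ℝ}

/-- Since `γ i j ≤ 2 * A * w j ≤ 2 * A * j` for `j ≥ i`, the mass norm of the difference already
controls the loss sums. -/
theorem abs_tailSum_sub_le (hγ : IsKernel A w γ) (hw : IsWeight w) (hx : Controlled w K x)
    (hy : Controlled w K y) {D : ℝ}
    (hD : ∀ n : ℕ, ∑ j ∈ Finset.Icc 1 n, (j : ℝ) * |x j - y j| ≤ D) {i : ℕ} (hi : 1 ≤ i) :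
    |tailSum γ x i - tailSum γ y i| ≤ 2 * A * D := by
  have hlim := ((summable_tail hγ hw hx hi).hasSum.tendsto_sum_nat.sub
    (summable_tail hγ hw hy hi).hasSum.tendsto_sum_nat).abs
  refine le_of_tendsto' hlim fun n => ?_
  rw [← Finset.sum_sub_distrib]
  have hA := hγ.const_pos
  calc |∑ k ∈ Finset.range n, (γ i (i + k) * x (i + k) - γ i (i + k) * y (i + k))|
      ≤ ∑ k ∈ Finset.range n, 2 * A * (((i + k : ℕ) : ℝ) * |x (i + k) - y (i + k)|) := by
        refine (Finset.abs_sum_le_sum_abs _ _).trans (Finset.sum_le_sum fun k _ => ?_)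
        have h1 : 0 ≤ γ i (i + k) := hγ.nonneg _ _ hi (by lia)
        have h2 : γ i (i + k) ≤ 2 * A * ((i + k : ℕ) : ℝ) :=
          (hγ.le_right hw hi (by lia)).trans
            (mul_le_mul_of_nonneg_left (hw.le_self (i + k) (by lia)) (by linarith))
        rw [← mul_sub, abs_mul, abs_of_nonneg h1, ← mul_assoc]
        exact mul_le_mul_of_nonneg_right h2 (abs_nonneg _)
    _ = 2 * A * ∑ j ∈ Finset.Ico i (i + n), (j : ℝ) * |x j - y j| := by
        rw [← Finset.mul_sum, Finset.range_eq_Ico,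
          Finset.sum_Ico_add (fun j : ℕ => (j : ℝ) * |x j - y j|) 0 n i, zero_add, add_comm n]
    _ ≤ 2 * A * D := by
        gcongr
        refine (Finset.sum_le_sum_of_subset_of_nonneg (fun j hj => ?_)
          fun j _ _ => by positivity).trans (hD (i + n))
        rw [Finset.mem_Ico] at hj
        exact Finset.mem_Icc.2 ⟨by lia, hj.2.le⟩

/-- The derivative of `∑_{i ≤ n} i * |x i - y i|` along the equation, in dissipative form. -/
theorem sum_abs_deriv_le (hγ : IsKernel A w γ) (hw : IsWeight w) (hx : Controlled w K x)
    (hy : Controlled w K y) {D : ℝ}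
    (hD : ∀ n : ℕ, ∑ j ∈ Finset.Icc 1 n, (j : ℝ) * |x j - y j| ≤ D) (n : ℕ) :
    ∑ i ∈ Finset.Icc 1 n, (i : ℝ) * (if x i - y i = 0 then |rhs γ x i - rhs γ y i|
      else (SignType.sign (x i - y i) : ℝ) * (rhs γ x i - rhs γ y i)) ≤ 10 * A * K * D := by
  have hA := hγ.const_pos
  have hK := hx.const_nonneg
  have hD0 : 0 ≤ D := by simpa using hD 0
  set P : ℕ → ℝ := fun i => ∑ j ∈ Finset.Icc 1 i, (j : ℝ) * γ i j * x j with hP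
  set Q : ℕ → ℝ := fun i => ∑ j ∈ Finset.Icc 1 i, (j : ℝ) * γ i j * |x j - y j| with hQ
  set F : ℕ → ℝ := fun i => |x i - y i| * P i with hF
  set H : ℕ → ℝ := fun i => y i * Q i with hH
  have hF0 : F 0 = 0 := by simp [hF, hP]
  have hH0 : H 0 = 0 := by simp [hH, hQ]
  have hPnn : ∀ i, 0 ≤ P i := gain_sum_nonneg hγ hx.nonneg
  have hQnn : ∀ i, 0 ≤ Q i := gain_sum_nonneg (x := fun j => |x j - y j|) hγ
    fun _ _ => abs_nonneg _
  have hFnn : ∀ i, 0 ≤ F i := fun i => mul_nonneg (abs_nonneg _) (hPnn i)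
  have hHnn : ∀ i, 0 ≤ H i := fun i => by
    rcases Nat.eq_zero_or_pos i with rfl | hi
    · exact hH0.ge
    · exact mul_nonneg (hy.nonneg i hi) (hQnn i)
  have hflux : ∀ i, |flux γ x i - flux γ y i - P i * (x i - y i)| ≤ H i := by
    intro i
    have h1 : flux γ x i - flux γ y i - P i * (x i - y i) =
        y i * ∑ j ∈ Finset.Icc 1 i, (j : ℝ) * γ i j * (x j - y j) := by
      simp only [flux, hP, mul_sub (_ * _ : ℝ), Finset.sum_sub_distrib]
      ring
    rcases Nat.eq_zero_or_pos i with rfl | hi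
    · simp [hP, hH, hQ]
    rw [h1, abs_mul, abs_of_nonneg (hy.nonneg i hi)]
    refine mul_le_mul_of_nonneg_left ((Finset.abs_sum_le_sum_abs _ _).trans_eq ?_) (hy.nonneg i hi)
    refine Finset.sum_congr rfl fun j hj => ?_
    obtain ⟨hj1, -⟩ := Finset.mem_Icc.1 hj
    rw [abs_mul, abs_of_nonneg (mul_nonneg (Nat.cast_nonneg j) (hγ.nonneg i j hi hj1))]
  have hterm : ∀ i ∈ Finset.Icc 1 n, (i : ℝ) * (if x i - y i = 0 then |rhs γ x i - rhs γ y i|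
      else (SignType.sign (x i - y i) : ℝ) * (rhs γ x i - rhs γ y i)) ≤
      (i : ℝ) * (F (i - 1) - F i) + (i : ℝ) * (H (i - 1) - H i) + 2 * ((i : ℝ) * H i)
        + 2 * A * D * ((i : ℝ) * y i) := by
    intro i hi
    obtain ⟨hi1, -⟩ := Finset.mem_Icc.1 hi
    have hU := abs_tailSum_sub_le hγ hw hx hy hD hi1
    have hUnn := tailSum_nonneg hγ hx.nonneg hi1
    -- The part linear in `x i - y i` is isolated, with damping coefficient `P i + tailSum γ x i`.
    -- The `P i` share supplies the `-F i` that telescopes with `F (i - 1)`; the other share is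
    -- dropped by sign.
    have hdiff : |rhs γ x i - rhs γ y i + (P i + tailSum γ x i) * (x i - y i)| ≤
        F (i - 1) + H (i - 1) + H i + y i * (2 * A * D) := by
      have h1 := abs_le.1 (hflux (i - 1))
      have h2 := abs_le.1 (hflux i)
      have h3 : |y i * (tailSum γ x i - tailSum γ y i)| ≤ y i * (2 * A * D) := by
        rw [abs_mul, abs_of_nonneg (hy.nonneg i hi1)]
        exact mul_le_mul_of_nonneg_left hU (hy.nonneg i hi1)
      replace h3 := abs_le.1 h3
      have h4 := abs_le.1 ((abs_mul (x (i - 1) - y (i - 1)) (P (i - 1))).le.trans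
        (by rw [abs_of_nonneg (hPnn (i - 1))] : _ ≤ F (i - 1)))
      rw [rhs_eq, rhs_eq, abs_le]
      constructor <;> linarith
    have h := abs_deriv_le hdiff
    have h5 : 0 ≤ tailSum γ x i * |x i - y i| := mul_nonneg hUnn (abs_nonneg _)
    have h6 : F i = |x i - y i| * P i := rfl
    refine (mul_le_mul_of_nonneg_left (h.trans (?_ : _ ≤ F (i - 1) - F i + (H (i - 1) - H i)
      + 2 * H i + 2 * A * D * y i)) (Nat.cast_nonneg i)).trans_eq (by ring)
    linarith
  refine (Finset.sum_le_sum hterm).trans ?_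
  simp only [Finset.sum_add_distrib, ← Finset.mul_sum]
  have hsF := sum_mul_sub_pred (fun i => (i : ℝ)) F hF0 n
  have hsH := sum_mul_sub_pred (fun i => (i : ℝ)) H hH0 n
  simp only [Nat.cast_add, Nat.cast_one, add_sub_cancel_left, one_mul] at hsF hsH
  rw [hsF, hsH]
  have hFn : 0 ≤ ((n : ℝ) + 1) * F n := mul_nonneg (by positivity) (hFnn n)
  have hHn : 0 ≤ ((n : ℝ) + 1) * H n := mul_nonneg (by positivity) (hHnn n)
  have hFsum : ∑ i ∈ Finset.Icc 1 n, F i ≤ 2 * A * K * D := by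
    calc ∑ i ∈ Finset.Icc 1 n, F i
        ≤ ∑ i ∈ Finset.Icc 1 n, 2 * A * K * ((i : ℝ) * |x i - y i|) := by
          refine Finset.sum_le_sum fun i hi => ?_
          obtain ⟨hi1, -⟩ := Finset.mem_Icc.1 hi
          have h1 : P i ≤ 2 * A * i * K :=
            (gain_sum_le hγ hw hx.nonneg (hx.sum_mul_le hw) hi1).trans (by
              gcongr
              exact hw.le_self i hi1)
          have := mul_le_mul_of_nonneg_left h1 (abs_nonneg (x i - y i))
          simp only [hF]
          linarith
      _ ≤ 2 * A * K * D := by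
          rw [← Finset.mul_sum]
          exact mul_le_mul_of_nonneg_left (hD n) (by positivity)
  have hHsum : ∑ i ∈ Finset.Icc 1 n, (i : ℝ) * H i ≤ 2 * A * K * D := by
    calc ∑ i ∈ Finset.Icc 1 n, (i : ℝ) * H i
        ≤ ∑ i ∈ Finset.Icc 1 n, 2 * A * D * ((i : ℝ) * w i * y i) := by
          refine Finset.sum_le_sum fun i hi => ?_
          obtain ⟨hi1, -⟩ := Finset.mem_Icc.1 hi
          have h1 : Q i ≤ 2 * A * w i * D :=
            gain_sum_le (x := fun j => |x j - y j|) hγ hw (fun _ _ => abs_nonneg _) hD hi1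
          have := mul_le_mul_of_nonneg_left h1
            (mul_nonneg (Nat.cast_nonneg (α := ℝ) i) (hy.nonneg i hi1))
          simp only [hH]
          linarith
      _ ≤ 2 * A * D * K := by
          rw [← Finset.mul_sum]
          exact mul_le_mul_of_nonneg_left (hy.sum_le n) (by positivity)
      _ = _ := by ring
  have hHsum' : ∑ i ∈ Finset.Icc 1 n, H i ≤ ∑ i ∈ Finset.Icc 1 n, (i : ℝ) * H i :=
    Finset.sum_le_sum fun i hi => le_mul_of_one_le_left (hHnn i)
      (by exact_mod_cast (Finset.mem_Icc.1 hi).1)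
  have hysum := mul_le_mul_of_nonneg_left (hy.sum_mul_le hw n)
    (by positivity : 0 ≤ 2 * A * D)
  -- In units of `A * K * D`: 2 from `F`, 2 from the telescoped `H`, 4 from `2 * i * H i`, and 2
  -- from the loss sums.
  linarith

/-- Two controlled classical solutions with the same initial value agree. -/
theorem IsRegularOn.eq_of_controlled {T : ℝ} {ξ η : ℝ → ℕ → ℝ} (hγ : IsKernel A w γ)
    (hw : IsWeight w) (hξ : IsRegularOn γ T ξ) (hη : IsRegularOn γ T η)
    (hξK : ∀ t ∈ Icc 0 T, Controlled w K (ξ t)) (hηK : ∀ t ∈ Icc 0 T, Controlled w K (η t))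
    (h0 : ∀ i : ℕ, 1 ≤ i → ξ 0 i = η 0 i) :
    ∀ t ∈ Icc 0 T, ∀ i : ℕ, 1 ≤ i → ξ t i = η t i := by
  set S : ℕ → ℝ → ℝ := fun n t => ∑ i ∈ Finset.Icc 1 n, (i : ℝ) * |ξ t i - η t i| with hS
  set C : ℝ := 10 * A * K with hC
  -- Picard-type iteration in place of Grönwall: `sum_abs_deriv_le` bounds one partial sum using a
  -- bound on all of them, so each step improves the estimate for every `n` simultaneously.
  have hbound : ∀ k : ℕ, ∀ n : ℕ, ∀ t ∈ Icc 0 T,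
      S n t ≤ 2 * K * ((C * t) ^ k / (k.factorial : ℝ)) := by
    intro k
    induction k with
    | zero =>
      intro n t ht
      have h1 := (hξK t ht).sum_mul_le hw n
      have h2 := (hηK t ht).sum_mul_le hw n
      have h3 : S n t ≤ ∑ i ∈ Finset.Icc 1 n, ((i : ℝ) * ξ t i + (i : ℝ) * η t i) := by
        refine Finset.sum_le_sum fun i hi => ?_
        obtain ⟨hi1, -⟩ := Finset.mem_Icc.1 hi
        rw [← mul_add]
        refine mul_le_mul_of_nonneg_left ?_ (Nat.cast_nonneg i)
        have h4 := (hξK t ht).nonneg i hi1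
        have h5 := (hηK t ht).nonneg i hi1
        rw [abs_le]
        constructor <;> linarith
      rw [Finset.sum_add_distrib] at h3
      simpa using (by linarith : S n t ≤ 2 * K)
    | succ k ih =>
      intro n t ht
      refine image_le_of_deriv_right_le_deriv_boundary (f := S n)
        (f' := fun s => ∑ i ∈ Finset.Icc 1 n, (i : ℝ) * (if ξ s i - η s i = 0 then
          |rhs γ (ξ s) i - rhs γ (η s) i| else (SignType.sign (ξ s i - η s i) : ℝ) *
            (rhs γ (ξ s) i - rhs γ (η s) i)))
        (B := fun s => 2 * K * ((C * s) ^ (k + 1) / ((k + 1).factorial : ℝ)))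
        (B' := fun s => C * (2 * K * ((C * s) ^ k / (k.factorial : ℝ)))) ?_ ?_ ?_ ?_ ?_ ?_ ht
      · refine continuousOn_finsetSum _ fun i hi => continuousOn_const.mul ?_
        obtain ⟨hi1, -⟩ := Finset.mem_Icc.1 hi
        exact ((hξ.continuousOn i hi1).sub (hη.continuousOn i hi1)).abs
      · intro s hs
        refine HasDerivWithinAt.fun_sum fun i hi => HasDerivWithinAt.const_mul _ ?_
        obtain ⟨hi1, -⟩ := Finset.mem_Icc.1 hi
        exact hasDerivWithinAt_abs_right ((hξ.hasDeriv i hi1 s hs).sub (hη.hasDeriv i hi1 s hs))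
      · have : S n 0 = 0 := Finset.sum_eq_zero fun i hi => by
          rw [h0 i (Finset.mem_Icc.1 hi).1]; simp
        rw [this]; simp
      · fun_prop
      · intro s _
        have h1 : HasDerivAt (fun s : ℝ => (C * s) ^ (k + 1)) (((k + 1 : ℕ) : ℝ) * (C * s) ^ k * C)
            s := by
          simpa using ((hasDerivAt_id s).const_mul C).fun_pow (k + 1)
        refine (((h1.div_const ((k + 1).factorial : ℝ)).const_mul (2 * K)).congr_deriv
          ?_).hasDerivWithinAt
        rw [Nat.factorial_succ]
        push_cast
        field_simp
      · intro s hs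
        have hs' := Ico_subset_Icc_self hs
        exact sum_abs_deriv_le hγ hw (hξK s hs') (hηK s hs') (fun m => ih m s hs') n
  intro t ht i hi
  have hlim : Tendsto (fun k : ℕ => 2 * K * ((C * t) ^ k / (k.factorial : ℝ))) atTop (𝓝 0) := by
    simpa using (FloorSemiring.tendsto_pow_div_factorial_atTop (C * t)).const_mul (2 * K)
  have hSi : S i t ≤ 0 := ge_of_tendsto' hlim fun k => hbound k i t ht
  have hle : (i : ℝ) * |ξ t i - η t i| ≤ 0 :=
    (Finset.single_le_sum (f := fun i : ℕ => (i : ℝ) * |ξ t i - η t i|)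
      (fun j _ => by positivity) (Finset.mem_Icc.2 ⟨hi, le_rfl⟩)).trans hSi
  have hi0 : (0 : ℝ) < i := by exact_mod_cast hi
  have : |ξ t i - η t i| = 0 :=
    le_antisymm (nonpos_of_mul_nonpos_right hle hi0) (abs_nonneg _)
  exact sub_eq_zero.1 (abs_eq_zero.1 this)

end Uniqueness

/-! ### The truncated equation -/

section Truncation

/-- The kernel cut off at sizes `≥ N`. -/
noncomputable def truncKernel (N : ℕ) (γ : ℕ → ℕ → ℝ) (i j : ℕ) : ℝ :=
  if (1 ≤ i ∧ i < N) ∧ 1 ≤ j ∧ j < N then γ i j else 0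

variable {A : ℝ} {w : ℕ → ℝ} {γ : ℕ → ℕ → ℝ} {K : ℝ} {N : ℕ}

theorem IsKernel.trunc (hγ : IsKernel A w γ) (hw : IsWeight w) (N : ℕ) :
    IsKernel A w (truncKernel N γ) where
  const_pos := hγ.const_pos
  nonneg i j hi hj := by
    rw [truncKernel]
    split_ifs
    exacts [hγ.nonneg i j hi hj, le_rfl]
  symm i j hi hj := by
    simp only [truncKernel, hγ.symm i j hi hj, and_comm]
  le i j hi hj := by
    rw [truncKernel]
    split_ifs
    · exact hγ.le i j hi hj
    · have h1 := hw.one_le i hi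
      have h2 := hw.one_le j hj
      exact mul_nonneg hγ.const_pos.le (by linarith)

theorem truncKernel_left {i : ℕ} (h : N ≤ i) (j : ℕ) : truncKernel N γ i j = 0 :=
  if_neg fun h' => by lia

theorem truncKernel_right {j : ℕ} (h : N ≤ j) (i : ℕ) : truncKernel N γ i j = 0 :=
  if_neg fun h' => by lia

theorem truncKernel_of_lt {i j : ℕ} (hi : 1 ≤ i) (hj : 1 ≤ j) (hiN : i < N) (hjN : j < N) :
    truncKernel N γ i j = γ i j :=
  if_pos ⟨⟨hi, hiN⟩, hj, hjN⟩

theorem tailSum_trunc (x : ℕ → ℝ) {i m : ℕ} (h : N ≤ i + m) :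
    tailSum (truncKernel N γ) x i =
      ∑ k ∈ Finset.range m, truncKernel N γ i (i + k) * x (i + k) :=
  tsum_eq_sum fun k hk => by
    rw [truncKernel_right (by rw [Finset.mem_range] at hk; lia), zero_mul]

theorem flux_trunc_of_le (x : ℕ → ℝ) {i : ℕ} (h : N ≤ i) : flux (truncKernel N γ) x i = 0 := by
  simp [flux, truncKernel_left h]

/-- The inequality is strict because sizes `N - 1` still feed size `N`; the truncated system lives
on the sizes `1, …, N`. -/
theorem rhs_trunc_of_lt (x : ℕ → ℝ) {i : ℕ} (h : N < i) : rhs (truncKernel N γ) x i = 0 := by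
  rw [rhs_eq, flux_trunc_of_le x (by lia), flux_trunc_of_le x h.le,
    tailSum_trunc x (m := 0) h.le]
  simp

/-- The truncated equation conserves mass. -/
theorem sum_mul_rhs_trunc (hγ : IsKernel A w γ) (hw : IsWeight w) (x : ℕ → ℝ) :
    ∑ i ∈ Finset.Icc 1 N, (i : ℝ) * rhs (truncKernel N γ) x i = 0 := by
  rw [sum_mul_rhs (hγ.trunc hw N), flux_trunc_of_le x le_rfl, mul_zero, neg_zero, zero_sub,
    neg_eq_zero]
  refine Finset.sum_eq_zero fun i hi => ?_
  rw [tailSum_trunc x (m := N + 1 - i) (by lia), sub_self, mul_zero, mul_zero]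

/-- The growth of the weighted moment along the truncated equation. -/
theorem sum_weight_mul_rhs_trunc_le (hγ : IsKernel A w γ) (hw : IsWeight w) {x : ℕ → ℝ}
    (hx : ∀ i : ℕ, 1 ≤ i → 0 ≤ x i) {M : ℝ}
    (hM : ∀ n : ℕ, ∑ j ∈ Finset.Icc 1 n, (j : ℝ) * x j ≤ M) :
    ∑ i ∈ Finset.Icc 1 N, (i : ℝ) * w i * rhs (truncKernel N γ) x i ≤
      6 * A * M * ∑ i ∈ Finset.Icc 1 N, (i : ℝ) * w i * x i := by
  have hγN := hγ.trunc hw N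
  have hA := hγ.const_pos
  have hM0 : 0 ≤ M := by simpa using hM 0
  have h := sum_mul_sub_pred (fun i => (i : ℝ) * w i) (flux (truncKernel N γ) x)
    (flux_zero _ x) N
  rw [flux_trunc_of_le x le_rfl, mul_zero, sub_zero] at h
  calc ∑ i ∈ Finset.Icc 1 N, (i : ℝ) * w i * rhs (truncKernel N γ) x i
      ≤ ∑ i ∈ Finset.Icc 1 N, (i : ℝ) * w i *
          (flux (truncKernel N γ) x (i - 1) - flux (truncKernel N γ) x i) := by
        refine Finset.sum_le_sum fun i hi => ?_
        obtain ⟨hi1, -⟩ := Finset.mem_Icc.1 hi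
        refine mul_le_mul_of_nonneg_left ?_
          (mul_nonneg (Nat.cast_nonneg i) (zero_le_one.trans (hw.one_le i hi1)))
        rw [rhs_eq]
        linarith [mul_nonneg (hx i hi1) (tailSum_nonneg hγN hx hi1)]
    _ = _ := h
    _ ≤ ∑ i ∈ Finset.Icc 1 N, 6 * A * M * ((i : ℝ) * w i * x i) := by
        refine Finset.sum_le_sum fun i hi => ?_
        obtain ⟨hi1, -⟩ := Finset.mem_Icc.1 hi
        have h1 := hw.one_le i hi1
        have h2 : ((i + 1 : ℕ) : ℝ) * w (i + 1) - i * w i ≤ 3 * w i := by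
          have := hw.succ_le i hi1
          push_cast
          linarith
        calc (((i + 1 : ℕ) : ℝ) * w (i + 1) - i * w i) * flux (truncKernel N γ) x i
            ≤ 3 * w i * (2 * A * M * (w i * x i)) :=
              mul_le_mul h2 (flux_le hγN hw hx hM hi1) (flux_nonneg hγN hx i) (by linarith)
          _ = 6 * A * M * (w i * (w i * x i)) := by ring
          -- Trading one factor `w i` for `i` closes the estimate; for `w i = i ^ δ` this is where
          -- `δ ≤ 1` enters.
          _ ≤ 6 * A * M * ((i : ℝ) * (w i * x i)) := by
              have := hw.le_self i hi1
              have := hx i hi1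
              gcongr
          _ = _ := by ring
    _ = _ := by rw [Finset.mul_sum]

end Truncation

/-! ### Tools from ordinary differential equations -/

section OrdinaryDifferentialEquations

/-- Coordinatewise projection to the cube `[0, M] ^ N`. -/
def clamp {N : ℕ} (M : ℝ) (v : Fin N → ℝ) : Fin N → ℝ := fun k => max 0 (min M (v k))

theorem clamp_mem {N : ℕ} {M : ℝ} (hM : 0 ≤ M) (v : Fin N → ℝ) :
    clamp M v ∈ Icc (0 : Fin N → ℝ) (fun _ => M) :=
  ⟨fun _ => le_max_left _ _, fun _ => max_le hM (min_le_left _ _)⟩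

theorem lipschitzWith_clamp {N : ℕ} (M : ℝ) : LipschitzWith 1 (clamp (N := N) M) := by
  refine LipschitzWith.of_dist_le_mul fun u v => ?_
  rw [NNReal.coe_one, one_mul, dist_pi_le_iff dist_nonneg]
  intro k
  refine le_trans ?_ (dist_le_pi_dist u v k)
  rw [Real.dist_eq, Real.dist_eq]
  simp only [clamp, max_comm (0 : ℝ), min_comm M]
  exact (abs_max_sub_max_le_abs (min (u k) M) (min (v k) M) 0).trans
    (abs_inf_sub_inf_le_abs (u k) (v k) M)

/-- A smooth vector field precomposed with the projection to a cube has global solutions. -/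
theorem exists_hasDerivWithinAt_clamp {N : ℕ} {G : (Fin N → ℝ) → Fin N → ℝ} (hG : ContDiff ℝ 1 G)
    {M : ℝ} (hM : 0 ≤ M) {T : ℝ} (hT : 0 ≤ T) (v : Fin N → ℝ) :
    ∃ α : ℝ → Fin N → ℝ, α 0 = v ∧
      ∀ t ∈ Icc 0 T, HasDerivWithinAt α (G (clamp M (α t))) (Icc 0 T) t := by
  have hcpt : IsCompact (Icc (0 : Fin N → ℝ) (fun _ => M)) := isCompact_Icc
  obtain ⟨L, hL⟩ := hG.contDiffOn.exists_lipschitzOnWith one_ne_zero (convex_Icc _ _) hcpt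
  obtain ⟨B, hB⟩ := hcpt.exists_bound_of_continuousOn hG.continuous.continuousOn
  -- The clamped field is bounded by `B`, so a ball of radius `B * T` cannot be left before time
  -- `T`.
  have hpl : IsPicardLindelof (fun _ u => G (clamp M u)) (⟨0, le_rfl, hT⟩ : Icc 0 T) v
      (B.toNNReal * T.toNNReal) 0 B.toNNReal (L * 1) := by
    refine IsPicardLindelof.of_time_independent (fun u _ => ?_) ?_ ?_
    · exact (hB _ (clamp_mem hM u)).trans (Real.le_coe_toNNReal B)
    · exact hL.comp (lipschitzWith_clamp M).lipschitzOnWith fun u _ => clamp_mem hM u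
    · simp [hT]
  exact hpl.exists_eq_forall_mem_Icc_hasDerivWithinAt₀

/-- A function that increases wherever it is non-positive stays non-negative. -/
theorem nonneg_of_hasDeriv_nonneg {f f' : ℝ → ℝ} {T : ℝ} (hf : ContinuousOn f (Icc 0 T))
    (hf' : ∀ t ∈ Ico 0 T, HasDerivWithinAt f (f' t) (Ici t) t) (h0 : 0 ≤ f 0)
    (h : ∀ t ∈ Ico 0 T, f t ≤ 0 → 0 ≤ f' t) : ∀ t ∈ Icc 0 T, 0 ≤ f t := by
  intro t ht
  refine le_of_forall_pos_lt_add fun ε hε => ?_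
  have ht1 : 0 < 1 + t := by linarith [ht.1]
  -- The barrier `c * (1 + s)` is positive with slope `c > 0`, while `-f` is non-increasing wherever
  -- they meet. At time `t` it equals `ε / 2`.
  set c := ε / (2 * (1 + t)) with hc
  have hc0 : 0 < c := by positivity
  have key := image_le_of_deriv_right_lt_deriv_boundary (f := fun s => -f s)
    (B := fun s => c * (1 + s)) (B' := fun _ => c) hf.neg (fun s hs => (hf' s hs).neg)
    (by linarith) (fun s => by simpa using ((hasDerivAt_id s).const_add 1).const_mul c)
    (fun s hs heq => by
      have h1 : 0 ≤ c * (1 + s) := mul_nonneg hc0.le (by linarith [hs.1])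
      linarith [h s hs (by linarith)]) ht
  have : c * (1 + t) = ε / 2 := by rw [hc]; field_simp
  linarith

theorem le_mul_exp_of_hasDeriv_le {f f' : ℝ → ℝ} {T c : ℝ} (hf : ContinuousOn f (Icc 0 T))
    (hf' : ∀ t ∈ Ico 0 T, HasDerivWithinAt f (f' t) (Ici t) t)
    (h : ∀ t ∈ Ico 0 T, f' t ≤ c * f t) : ∀ t ∈ Icc 0 T, f t ≤ f 0 * Real.exp (c * t) := by
  intro t ht
  have hexp : ∀ s : ℝ, HasDerivAt (fun s => Real.exp (-c * s)) (Real.exp (-c * s) * (-c)) s :=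
    fun s => by simpa using ((hasDerivAt_id s).const_mul (-c)).exp
  have key := image_le_of_deriv_right_le_deriv_boundary
    (f := fun s => f s * Real.exp (-c * s)) (B := fun _ => f 0) (B' := fun _ => 0)
    (hf.mul (by fun_prop)) (fun s hs => (hf' s hs).mul (hexp s).hasDerivWithinAt)
    (by simp) continuousOn_const (fun s _ => hasDerivWithinAt_const _ _ _)
    (fun s hs => by nlinarith [h s hs, Real.exp_pos (-c * s)]) ht
  have h1 : Real.exp (-c * t) * Real.exp (c * t) = 1 := by
    rw [← Real.exp_add]; simp
  calc f t = f t * Real.exp (-c * t) * Real.exp (c * t) := by rw [mul_assoc, h1, mul_one]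
    _ ≤ _ := by gcongr

end OrdinaryDifferentialEquations

/-! ### Global solutions of the truncated equation -/

section Approximation

/-- A vector indexed by the sizes `1, …, N` as a sequence. -/
noncomputable def toSeq {N : ℕ} (v : Fin N → ℝ) (i : ℕ) : ℝ :=
  if h : 1 ≤ i ∧ i ≤ N then v ⟨i - 1, by lia⟩ else 0

theorem toSeq_clamp {N : ℕ} {M : ℝ} (hM : 0 ≤ M) (v : Fin N → ℝ) (i : ℕ) :
    toSeq (clamp M v) i = max 0 (min M (toSeq v i)) := by
  rw [toSeq, toSeq]
  split_ifs
  · rfl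
  · simp [hM]

theorem contDiff_toSeq {N : ℕ} (i : ℕ) : ContDiff ℝ 1 fun v : Fin N → ℝ => toSeq v i := by
  simp only [toSeq]
  split_ifs
  · exact contDiff_apply ℝ ℝ _
  · exact contDiff_const

theorem contDiff_rhs_trunc (N : ℕ) (γ : ℕ → ℕ → ℝ) (i : ℕ) :
    ContDiff ℝ 1 fun v : Fin N → ℝ => rhs (truncKernel N γ) (toSeq v) i := by
  have hflux : ∀ j, ContDiff ℝ 1 fun v : Fin N → ℝ => flux (truncKernel N γ) (toSeq v) j :=
    fun j => (contDiff_toSeq j).mul (ContDiff.sum fun l _ => contDiff_const.mul (contDiff_toSeq l))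
  simp only [rhs_eq, tailSum_trunc _ (Nat.le_add_left N i)]
  exact ((hflux _).sub (hflux _)).sub
    ((contDiff_toSeq i).mul (ContDiff.sum fun l _ => contDiff_const.mul (contDiff_toSeq _)))

variable {A : ℝ} {w : ℕ → ℝ} {γ : ℕ → ℕ → ℝ} {K : ℝ} {xin : ℕ → ℝ}

theorem sum_le_of_support {N : ℕ} {g x : ℕ → ℝ} (hg : ∀ i : ℕ, 1 ≤ i → 0 ≤ g i * x i)
    (hx : ∀ i : ℕ, N < i → x i = 0) (n : ℕ) :
    ∑ i ∈ Finset.Icc 1 n, g i * x i ≤ ∑ i ∈ Finset.Icc 1 N, g i * x i := by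
  calc ∑ i ∈ Finset.Icc 1 n, g i * x i ≤ ∑ i ∈ Finset.Icc 1 (max n N), g i * x i :=
        Finset.sum_le_sum_of_subset_of_nonneg
          (Finset.Icc_subset_Icc_right (le_max_left _ _)) fun i hi _ =>
            hg i (Finset.mem_Icc.1 hi).1
    _ = _ := by
        symm
        refine Finset.sum_subset (Finset.Icc_subset_Icc_right (le_max_right _ _)) fun i hi hi' => ?_
        rw [Finset.mem_Icc] at hi hi'
        rw [hx i (by lia), mul_zero]

/-- Solutions of the truncated equation, with bounds independent of the truncation. -/
theorem exists_regular_trunc (hγ : IsKernel A w γ) (hw : IsWeight w) (hxin : Controlled w K xin)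
    (N : ℕ) {T : ℝ} (hT : 0 ≤ T) :
    ∃ x : ℝ → ℕ → ℝ, (∀ i ∈ Finset.Icc 1 N, x 0 i = xin i) ∧
      IsRegularOn (truncKernel N γ) T x ∧
      ∀ t ∈ Icc 0 T, Controlled w (K * Real.exp (6 * A * K * t)) (x t) := by
  have hK := hxin.const_nonneg
  have hγN := hγ.trunc hw N
  obtain ⟨α, hα0, hα⟩ := exists_hasDerivWithinAt_clamp
    (G := fun v k => rhs (truncKernel N γ) (toSeq v) (k + 1))
    (contDiff_pi.2 fun k => contDiff_rhs_trunc N γ (k + 1)) hK hT (fun k => xin (k + 1))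
  set x : ℝ → ℕ → ℝ := fun t => toSeq (α t) with hxdef
  set c : ℝ → ℕ → ℝ := fun t => toSeq (clamp K (α t)) with hcdef
  have hcx : ∀ t i, c t i = max 0 (min K (x t i)) := fun t i => toSeq_clamp hK _ _
  have hcnn : ∀ t i, 0 ≤ c t i := fun t i => by rw [hcx]; exact le_max_left _ _
  have hsupp : ∀ t i, N < i → x t i = 0 := fun t i hi => dif_neg (by lia)
  have hx0 : ∀ i ∈ Finset.Icc 1 N, x 0 i = xin i := fun i hi => by
    rw [Finset.mem_Icc] at hi
    simp only [hxdef, toSeq, hα0, dif_pos hi]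
    rw [Nat.sub_add_cancel hi.1]
  have hderiv : ∀ i, 1 ≤ i → ∀ t ∈ Icc 0 T,
      HasDerivWithinAt (fun s => x s i) (rhs (truncKernel N γ) (c t) i) (Icc 0 T) t := by
    intro i hi t ht
    by_cases hiN : i ≤ N
    · have h := hasDerivWithinAt_pi.1 (hα t ht) ⟨i - 1, by lia⟩
      simp only [hxdef, toSeq, dif_pos (And.intro hi hiN)]
      simpa only [Nat.sub_add_cancel hi] using h
    · rw [rhs_trunc_of_lt _ (by lia)]
      simp only [fun s => hsupp s i (by lia)]
      exact hasDerivWithinAt_const _ _ _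
  have hcont : ∀ i, 1 ≤ i → ContinuousOn (fun t => x t i) (Icc 0 T) :=
    fun i hi t ht => (hderiv i hi t ht).continuousWithinAt
  have hright : ∀ i, 1 ≤ i → ∀ t ∈ Ico 0 T,
      HasDerivWithinAt (fun s => x s i) (rhs (truncKernel N γ) (c t) i) (Ici t) t :=
    fun i hi t ht => (hderiv i hi t (Ico_subset_Icc_self ht)).mono_of_mem_nhdsWithin
      (mem_of_superset (Icc_mem_nhdsGE ht.2) (Icc_subset_Icc_left ht.1))
  have hnn : ∀ t ∈ Icc 0 T, ∀ i, 1 ≤ i → 0 ≤ x t i := by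
    intro t ht i hi
    refine nonneg_of_hasDeriv_nonneg (hcont i hi) (hright i hi) ?_ (fun s _ hs => ?_) t ht
    · by_cases hiN : i ≤ N
      · rw [hx0 i (Finset.mem_Icc.2 ⟨hi, hiN⟩)]
        exact hxin.nonneg i hi
      · rw [hsupp 0 i (by lia)]
    -- Where `x s i ≤ 0` the clamped coordinate vanishes, and only the gain term survives.
    · have hc0 : c s i = 0 := by rw [hcx]; exact max_eq_left ((min_le_right _ _).trans hs)
      rw [rhs_eq, flux, flux, hc0]
      have := flux_nonneg hγN (fun j _ => hcnn s j) (i - 1)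
      rw [flux] at this
      linarith
  have hmass : ∀ t ∈ Icc 0 T, ∀ n : ℕ, ∑ i ∈ Finset.Icc 1 n, (i : ℝ) * x t i ≤ K := by
    intro t ht n
    -- The mass identity holds for every sequence, hence also for the field evaluated at the clamped
    -- point.
    have hconst := constant_of_has_deriv_right_zero
      (f := fun s => ∑ i ∈ Finset.Icc 1 N, (i : ℝ) * x s i)
      (continuousOn_finsetSum _ fun i hi =>
        continuousOn_const.mul (hcont i (Finset.mem_Icc.1 hi).1))
      (fun s hs => by
        rw [← sum_mul_rhs_trunc hγ hw (c s) (N := N)]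
        exact HasDerivWithinAt.fun_sum fun i hi =>
          (hright i (Finset.mem_Icc.1 hi).1 s hs).const_mul _) t ht
    refine (sum_le_of_support (g := fun i => (i : ℝ))
      (fun i hi => mul_nonneg (Nat.cast_nonneg i) (hnn t ht i hi)) (hsupp t) n).trans ?_
    rw [hconst, Finset.sum_congr rfl fun i hi => by rw [hx0 i hi]]
    exact hxin.sum_mul_le hw N
  -- Non-negativity and mass at most `K` confine `x` to the cube, so the projection was never
  -- active.
  have hcx' : ∀ t ∈ Icc 0 T, c t = x t := by
    intro t ht
    funext i
    rw [hcx]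
    rcases Nat.eq_zero_or_pos i with rfl | hi
    · have : x t 0 = 0 := dif_neg (by lia)
      simp [this, hK]
    · have h1 := hnn t ht i hi
      have h2 : (i : ℝ) * x t i ≤ K :=
        (Finset.single_le_sum (f := fun i : ℕ => (i : ℝ) * x t i)
          (fun j hj => mul_nonneg (Nat.cast_nonneg j) (hnn t ht j (Finset.mem_Icc.1 hj).1))
          (Finset.mem_Icc.2 ⟨hi, le_rfl⟩)).trans (hmass t ht i)
      have h3 : x t i ≤ i * x t i := le_mul_of_one_le_left h1 (by exact_mod_cast hi)
      rw [min_eq_right (h3.trans h2), max_eq_right h1]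
  have hreg : IsRegularOn (truncKernel N γ) T x := ⟨hcont, fun i hi t ht => by
    rw [← hcx' t (Ico_subset_Icc_self ht)]
    exact hright i hi t ht⟩
  refine ⟨x, hx0, hreg, fun t ht => ⟨hnn t ht, fun n => ?_⟩⟩
  have hexp := le_mul_exp_of_hasDeriv_le (c := 6 * A * K)
    (f := fun s => ∑ i ∈ Finset.Icc 1 N, (i : ℝ) * w i * x s i)
    (continuousOn_finsetSum _ fun i hi =>
      continuousOn_const.mul (hcont i (Finset.mem_Icc.1 hi).1))
    (fun s hs => HasDerivWithinAt.fun_sum fun i hi =>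
      (hreg.hasDeriv i (Finset.mem_Icc.1 hi).1 s hs).const_mul _)
    (fun s hs => sum_weight_mul_rhs_trunc_le hγ hw (hnn s (Ico_subset_Icc_self hs))
      (hmass s (Ico_subset_Icc_self hs))) t ht
  refine (sum_le_of_support (g := fun i => (i : ℝ) * w i) (fun i hi => mul_nonneg
    (mul_nonneg (Nat.cast_nonneg i) (zero_le_one.trans (hw.one_le i hi))) (hnn t ht i hi))
    (hsupp t) n).trans (hexp.trans ?_)
  refine mul_le_mul_of_nonneg_right ?_ (Real.exp_pos _).le
  rw [Finset.sum_congr rfl fun i hi => by rw [hx0 i hi]]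
  exact hxin.sum_le N

end Approximation

/-! ### Compactness -/

section Compactness

/-- Arzelà–Ascoli for sequences of curves in the space of sequences, with pointwise convergence. -/
theorem exists_subseq_tendsto {y : ℕ → ℝ → ℕ → ℝ}
    (hbdd : ∀ (t : ℝ) (i : ℕ), 1 ≤ i → ∃ B, ∀ n, |y n t i| ≤ B)
    (hlip : ∀ (T : ℝ) (i : ℕ), 1 ≤ i → ∃ L, ∀ᶠ n in atTop, ∀ s ∈ Icc 0 T, ∀ t ∈ Icc s T,
      |y n t i - y n s i| ≤ L * (t - s)) :
    ∃ φ : ℕ → ℕ, StrictMono φ ∧ ∃ ξ : ℝ → ℕ → ℝ, ∀ t : ℝ, 0 ≤ t → ∀ i : ℕ, 1 ≤ i →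
      Tendsto (fun n => y (φ n) t i) atTop (𝓝 (ξ t i)) := by
  choose B hB using fun p : ℚ × ℕ => hbdd p.1 (p.2 + 1) (Nat.le_add_left 1 _)
  -- Tychonoff over the countable set of rational times and sizes replaces a diagonal argument.
  have hcpt : IsCompact (Set.pi univ fun p : ℚ × ℕ => Icc (-B p) (B p)) :=
    isCompact_univ_pi fun _ => isCompact_Icc
  obtain ⟨a, -, φ, hφ, hlim⟩ := hcpt.tendsto_subseq
    (x := fun n (p : ℚ × ℕ) => y n p.1 (p.2 + 1)) fun n p _ => abs_le.1 (hB p n)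
  rw [tendsto_pi_nhds] at hlim
  have hex : ∀ t : ℝ, ∀ i : ℕ, ∃ l : ℝ, 0 ≤ t → 1 ≤ i →
      Tendsto (fun n => y (φ n) t i) atTop (𝓝 l) := by
    intro t i
    by_cases h : 0 ≤ t ∧ 1 ≤ i
    swap
    · exact ⟨0, fun h1 h2 => absurd ⟨h1, h2⟩ h⟩
    obtain ⟨ht, hi⟩ := h
    obtain ⟨L, hL⟩ := hlip (t + 1) i hi
    suffices hc : CauchySeq fun n => y (φ n) t i by
      obtain ⟨l, hl⟩ := cauchySeq_tendsto_of_complete hc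
      exact ⟨l, fun _ _ => hl⟩
    rw [Metric.cauchySeq_iff']
    intro ε hε
    -- The cap `1` keeps `q` inside `[0, t + 1]`, where `L` is valid; `|L| + 1` keeps the
    -- denominator positive.
    set d := min 1 (ε / (4 * (|L| + 1))) with hd
    have hd0 : 0 < d := by positivity
    obtain ⟨q, hq1, hq2⟩ := exists_rat_btwn (lt_add_of_pos_right t hd0)
    have hsmall : ∀ᶠ n in atTop, |y (φ n) q i - y (φ n) t i| ≤ ε / 4 := by
      filter_upwards [hφ.tendsto_atTop.eventually hL] with n hn
      refine (hn t ⟨ht, by linarith⟩ q ⟨hq1.le, ?_⟩).trans ?_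
      · linarith [min_le_left 1 (ε / (4 * (|L| + 1)))]
      · have h1 : (q : ℝ) - t ≤ ε / (4 * (|L| + 1)) := by
          linarith [min_le_right 1 (ε / (4 * (|L| + 1)))]
        calc L * (q - t) ≤ (|L| + 1) * (ε / (4 * (|L| + 1))) :=
              mul_le_mul (by linarith [le_abs_self L]) h1 (by linarith) (by positivity)
          _ = ε / 4 := by field_simp
    have hq : CauchySeq fun n => y (φ n) q i := by
      have := (hlim (q, i - 1)).cauchySeq
      simpa only [Function.comp_def, Nat.sub_add_cancel hi] using this
    obtain ⟨N1, hN1⟩ := eventually_atTop.1 hsmall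
    obtain ⟨N2, hN2⟩ := Metric.cauchySeq_iff.1 hq (ε / 4) (by positivity)
    refine ⟨max N1 N2, fun n hn => ?_⟩
    have h1 := abs_le.1 (hN1 n (le_of_max_le_left hn))
    have h2 := abs_le.1 (hN1 (max N1 N2) (le_max_left _ _))
    have h3 := abs_lt.1 (hN2 n (le_of_max_le_right hn) (max N1 N2) (le_max_right _ _))
    rw [Real.dist_eq, abs_lt]
    constructor <;> linarith
  choose ξ hξ using hex
  exact ⟨φ, hφ, ξ, fun t ht i hi => hξ t i ht hi⟩

end Compactness

/-! ### Passage to the limit -/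

section Limit

variable {A : ℝ} {w : ℕ → ℝ} {γ : ℕ → ℕ → ℝ} {K : ℝ}

theorem Controlled.mono {x : ℕ → ℝ} {K' : ℝ} (h : Controlled w K x) (hK : K ≤ K') :
    Controlled w K' x :=
  ⟨h.nonneg, fun n => (h.sum_le n).trans hK⟩

theorem Controlled.of_tendsto {X : ℕ → ℕ → ℝ} {x : ℕ → ℝ}
    (hX : ∀ᶠ n in atTop, Controlled w K (X n))
    (hlim : ∀ i : ℕ, 1 ≤ i → Tendsto (fun n => X n i) atTop (𝓝 (x i))) : Controlled w K x where
  nonneg i hi := ge_of_tendsto (hlim i hi) (hX.mono fun _ h => h.nonneg i hi)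
  sum_le m := le_of_tendsto (tendsto_finsetSum _ fun i hi =>
    (hlim i (Finset.mem_Icc.1 hi).1).const_mul _) (hX.mono fun _ h => h.sum_le m)

theorem tendsto_flux_trunc {X : ℕ → ℕ → ℝ} {x : ℕ → ℝ} {N : ℕ → ℕ} (hN : Tendsto N atTop atTop)
    (hlim : ∀ i : ℕ, 1 ≤ i → Tendsto (fun n => X n i) atTop (𝓝 (x i))) (i : ℕ) :
    Tendsto (fun n => flux (truncKernel (N n) γ) (X n) i) atTop (𝓝 (flux γ x i)) := by
  rcases Nat.eq_zero_or_pos i with rfl | hi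
  · simp
  have h : Tendsto (fun n => flux γ (X n) i) atTop (𝓝 (flux γ x i)) :=
    (hlim i hi).mul (tendsto_finsetSum _ fun j hj =>
      (hlim j (Finset.mem_Icc.1 hj).1).const_mul _)
  refine h.congr' ?_
  filter_upwards [hN.eventually_gt_atTop i] with n hn
  rw [flux, flux]
  congr 1
  refine Finset.sum_congr rfl fun j hj => ?_
  obtain ⟨h1, h2⟩ := Finset.mem_Icc.1 hj
  rw [truncKernel_of_lt hi h1 hn (by lia)]

/-- Up to a fixed cut `m` the truncation is eventually inactive. Both remainders lie between `0` and
`ε / 2`, so their difference costs only `ε / 2`. -/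
theorem tendsto_tailSum_trunc (hγ : IsKernel A w γ) (hw : IsWeight w) {X : ℕ → ℕ → ℝ}
    {x : ℕ → ℝ} {N : ℕ → ℕ} (hN : Tendsto N atTop atTop)
    (hX : ∀ᶠ n in atTop, Controlled w K (X n))
    (hlim : ∀ i : ℕ, 1 ≤ i → Tendsto (fun n => X n i) atTop (𝓝 (x i))) {i : ℕ} (hi : 1 ≤ i) :
    Tendsto (fun n => tailSum (truncKernel (N n) γ) (X n) i) atTop (𝓝 (tailSum γ x i)) := by
  have hx := Controlled.of_tendsto hX hlim
  rw [Metric.tendsto_nhds]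
  intro ε hε
  obtain ⟨m, hm⟩ := ((tendsto_const_div_add (2 * A * K) i).eventually
    (gt_mem_nhds (by positivity : 0 < ε / 2))).exists
  have hfin : Tendsto (fun n => ∑ k ∈ Finset.range m, γ i (i + k) * X n (i + k)) atTop
      (𝓝 (∑ k ∈ Finset.range m, γ i (i + k) * x (i + k))) :=
    tendsto_finsetSum _ fun k _ => (hlim (i + k) (by lia)).const_mul _
  filter_upwards [hX, hN.eventually_gt_atTop (i + m),
    (Metric.tendsto_nhds.1 hfin) (ε / 2) (by positivity)] with n hXn hNn hd
  have hsum : ∑ k ∈ Finset.range m, truncKernel (N n) γ i (i + k) * X n (i + k) =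
      ∑ k ∈ Finset.range m, γ i (i + k) * X n (i + k) := by
    refine Finset.sum_congr rfl fun k hk => ?_
    rw [Finset.mem_range] at hk
    rw [truncKernel_of_lt hi (by lia) (by lia) (by lia)]
  have h1 := sum_range_le_tailSum (hγ.trunc hw (N n)) hw hXn hi m
  have h2 := tailSum_le (hγ.trunc hw (N n)) hw hXn hi m
  have h3 := sum_range_le_tailSum hγ hw hx hi m
  have h4 := tailSum_le hγ hw hx hi m
  rw [hsum] at h1 h2
  rw [Real.dist_eq, abs_lt] at hd ⊢
  constructor <;> linarith [hd.1, hd.2]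

theorem tendsto_rhs_trunc (hγ : IsKernel A w γ) (hw : IsWeight w) {X : ℕ → ℕ → ℝ}
    {x : ℕ → ℝ} {N : ℕ → ℕ} (hN : Tendsto N atTop atTop)
    (hX : ∀ᶠ n in atTop, Controlled w K (X n))
    (hlim : ∀ i : ℕ, 1 ≤ i → Tendsto (fun n => X n i) atTop (𝓝 (x i))) {i : ℕ} (hi : 1 ≤ i) :
    Tendsto (fun n => rhs (truncKernel (N n) γ) (X n) i) atTop (𝓝 (rhs γ x i)) := by
  simp only [rhs_eq]
  exact ((tendsto_flux_trunc hN hlim _).sub (tendsto_flux_trunc hN hlim _)).sub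
    ((hlim i hi).mul (tendsto_tailSum_trunc hγ hw hN hX hlim hi))

theorem IsRegularOn.abs_sub_le {T : ℝ} {ξ : ℝ → ℕ → ℝ} (h : IsRegularOn γ T ξ)
    (hγ : IsKernel A w γ) (hw : IsWeight w) {T' : ℝ} (hT' : T' ≤ T)
    (hK : ∀ t ∈ Icc 0 T', Controlled w K (ξ t)) {i : ℕ} (hi : 1 ≤ i) {s : ℝ} (hs : 0 ≤ s) {t : ℝ}
    (ht : t ∈ Icc s T') : |ξ t i - ξ s i| ≤ 2 * A * K * K * 2 * (t - s) :=
  norm_image_sub_le_of_norm_deriv_right_le_segment (f := fun t => ξ t i)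
    ((h.continuousOn i hi).mono (Icc_subset_Icc hs hT'))
    (fun r hr => h.hasDeriv i hi r ⟨hs.trans hr.1, hr.2.trans_le hT'⟩)
    (fun r hr => abs_rhs_le hγ hw (hK r ⟨hs.trans hr.1, hr.2.le⟩) hi) t ht

theorem IsRegularOn.sub_eq_integral {T : ℝ} {ξ : ℝ → ℕ → ℝ} (h : IsRegularOn γ T ξ)
    (hγ : IsKernel A w γ) (hw : IsWeight w) {t : ℝ} (ht : t ∈ Icc 0 T)
    (hK : ∀ s ∈ Icc 0 t, Controlled w K (ξ s)) {i : ℕ} (hi : 1 ≤ i) :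
    ContinuousOn (fun s => rhs γ (ξ s) i) (Icc 0 t) ∧
      ∫ s in (0 : ℝ)..t, rhs γ (ξ s) i = ξ t i - ξ 0 i := by
  have hc : ContinuousOn (fun s => rhs γ (ξ s) i) (Icc 0 t) :=
    continuousOn_rhs hγ hw
      (fun j hj => (h.continuousOn j hj).mono (Icc_subset_Icc_right ht.2)) hK hi
  refine ⟨hc, intervalIntegral.integral_eq_sub_of_hasDeriv_right (f := fun s => ξ s i) ?_ ?_ ?_⟩
  · rw [uIcc_of_le ht.1]
    exact (h.continuousOn i hi).mono (Icc_subset_Icc_right ht.2)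
  · rw [min_eq_left ht.1, max_eq_right ht.1]
    intro s hs
    exact (h.hasDeriv i hi s ⟨hs.1.le, hs.2.trans_le ht.2⟩).mono Ioi_subset_Ici_self
  · exact ContinuousOn.intervalIntegrable (by rwa [uIcc_of_le ht.1])

/-- Existence of a solution with locally bounded weighted moment. -/
theorem exists_isSolution (hγ : IsKernel A w γ) (hw : IsWeight w) {xin : ℕ → ℝ}
    (hxin : Controlled w K xin) :
    ∃ ξ : ℝ → ℕ → ℝ, IsSolution γ xin ⊤ ξ ∧
      ∀ t : ℝ, 0 ≤ t → Controlled w (K * Real.exp (6 * A * K * t)) (ξ t) := by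
  have hA := hγ.const_pos
  have hK := hxin.const_nonneg
  set κ : ℝ → ℝ := fun t => K * Real.exp (6 * A * K * t) with hκ
  have hκmono : ∀ s t, s ≤ t → κ s ≤ κ t := fun s t hst => by
    simp only [hκ]
    gcongr
  have hκnn : ∀ t, 0 ≤ κ t := fun t => by positivity
  choose x hx0 hreg hctrl using fun N : ℕ =>
    exists_regular_trunc hγ hw hxin N (Nat.cast_nonneg (α := ℝ) N)
  classical
  -- The `N`-th approximation is solved on `[0, N]`, so every bounded time interval is eventually
  -- covered; the value `0` elsewhere only keeps the family bounded.
  set y : ℕ → ℝ → ℕ → ℝ := fun N t i => if t ∈ Icc (0 : ℝ) N then x N t i else 0 with hy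
  have hyx : ∀ N : ℕ, ∀ t ∈ Icc (0 : ℝ) N, y N t = x N t := fun N t ht => by
    funext i; exact if_pos ht
  have hctrl' : ∀ {N : ℕ} {T : ℝ}, T ≤ N → ∀ t ∈ Icc 0 T, Controlled w (κ T) (x N t) :=
    fun hTN t ht => (hctrl _ t ⟨ht.1, ht.2.trans hTN⟩).mono (hκmono t _ ht.2)
  have hev : ∀ T : ℝ, ∀ᶠ N : ℕ in atTop, T ≤ N := fun T =>
    tendsto_natCast_atTop_atTop.eventually_ge_atTop T
  obtain ⟨φ, hφ, ξ, hξ⟩ := exists_subseq_tendsto (y := y)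
    (fun t i hi => ⟨κ t, fun N => by
      by_cases ht : t ∈ Icc (0 : ℝ) N
      · have h := hctrl N t ht
        rw [hyx N t ht, abs_of_nonneg (h.nonneg i hi)]
        exact h.apply_le hw hi
      · simp only [hy, if_neg ht, abs_zero]
        exact hκnn t⟩)
    (fun T i hi => ⟨2 * A * κ T * κ T * 2, by
      filter_upwards [hev T] with N hN s hs t ht
      rw [hyx N s ⟨hs.1, hs.2.trans hN⟩, hyx N t ⟨hs.1.trans ht.1, ht.2.trans hN⟩]
      exact (hreg N).abs_sub_le (hγ.trunc hw N) hw hN (hctrl' hN) hi hs.1 ht⟩)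
  have hφt := hφ.tendsto_atTop
  have hξx : ∀ t : ℝ, 0 ≤ t → ∀ i : ℕ, 1 ≤ i →
      Tendsto (fun n => x (φ n) t i) atTop (𝓝 (ξ t i)) := fun t ht i hi => by
    refine (hξ t ht i hi).congr' ?_
    filter_upwards [hφt.eventually (hev t)] with n hn
    rw [hyx _ t ⟨ht, hn⟩]
  have hctrlξ : ∀ t : ℝ, 0 ≤ t → Controlled w (κ t) (ξ t) := fun t ht => by
    refine Controlled.of_tendsto (X := fun n => x (φ n) t) ?_ (hξx t ht)
    filter_upwards [hφt.eventually (hev t)] with n hn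
    exact hctrl _ t ⟨ht, hn⟩
  have hcontT : ∀ T : ℝ, ∀ i : ℕ, 1 ≤ i → ContinuousOn (fun t => ξ t i) (Icc 0 T) := by
    intro T i hi
    have hle : ∀ s ∈ Icc 0 T, ∀ t ∈ Icc s T,
        |ξ t i - ξ s i| ≤ 2 * A * κ T * κ T * 2 * (t - s) := by
      intro s hs t ht
      refine le_of_tendsto ((hξx t (hs.1.trans ht.1) i hi).sub (hξx s hs.1 i hi)).abs ?_
      filter_upwards [hφt.eventually (hev T)] with n hn
      exact (hreg _).abs_sub_le (hγ.trunc hw _) hw hn (hctrl' hn) hi hs.1 ht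
    have hL : 0 ≤ 2 * A * κ T * κ T * 2 := by have := hκnn T; positivity
    refine LipschitzOnWith.continuousOn (K := (2 * A * κ T * κ T * 2).toNNReal)
      (LipschitzOnWith.of_dist_le_mul fun s hs t ht => ?_)
    rw [Real.coe_toNNReal _ hL]
    rcases le_total s t with hst | hst
    · rw [dist_comm, dist_comm s t, Real.dist_eq, Real.dist_eq, abs_of_nonneg (sub_nonneg.2 hst)]
      exact hle s hs t ⟨hst, ht.2⟩
    · rw [Real.dist_eq, Real.dist_eq, abs_of_nonneg (sub_nonneg.2 hst)]
      exact hle t ht s ⟨hst, hs.2⟩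
  refine ⟨ξ, ⟨fun i hi t ht _ => (hctrlξ t ht).nonneg i hi, fun i hi t ht => ?_,
    fun i hi t _ _ => ?_, fun i hi t _ _ => ?_, fun i hi t ht _ => ?_⟩, hctrlξ⟩
  · refine (hcontT (t + 1) i hi t ⟨ht.1, by linarith⟩).mono_of_mem_nhdsWithin ?_
    filter_upwards [self_mem_nhdsWithin,
      mem_nhdsWithin_of_mem_nhds (Iio_mem_nhds (lt_add_one t))] with s hs hs'
    exact ⟨hs.1, hs'.le⟩
  · filter_upwards [ae_restrict_mem measurableSet_Ioo] with s hs
    exact summable_tailLoss hγ hw (hctrlξ s hs.1.le) hi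
  · simp only [tailLoss_eq]
    refine IntegrableOn.mono_set (ContinuousOn.integrableOn_Icc ?_) Ioo_subset_Icc_self
    exact (hcontT t i hi).mul (continuousOn_tailSum hγ hw (hcontT t)
      (fun s hs => (hctrlξ s hs.1).mono (hκmono s t hs.2)) hi)
  · have hint : ∀ᶠ n in atTop, t ≤ φ n ∧ i ≤ φ n := by
      filter_upwards [hφt.eventually (hev t), hφt.eventually_ge_atTop i] with n h1 h2
      exact ⟨h1, h2⟩
    have hlim : Tendsto (fun n => ∫ s in (0 : ℝ)..t, rhs (truncKernel (φ n) γ) (x (φ n) s) i) atTop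
        (𝓝 (∫ s in (0 : ℝ)..t, rhs γ (ξ s) i)) := by
      refine intervalIntegral.tendsto_integral_filter_of_dominated_convergence
        (fun _ => 2 * A * κ t * κ t * 2) ?_ ?_ (by simp) ?_
      · filter_upwards [hint] with n hn
        rw [uIoc_of_le ht.le]
        exact (((hreg (φ n)).sub_eq_integral (hγ.trunc hw _) hw ⟨ht.le, hn.1⟩
          (hctrl' hn.1) hi).1.mono Ioc_subset_Icc_self).aestronglyMeasurable measurableSet_Ioc
      · filter_upwards [hint] with n hn
        refine Eventually.of_forall fun s hs => ?_
        rw [uIoc_of_le ht.le] at hs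
        exact abs_rhs_le (hγ.trunc hw _) hw (hctrl' hn.1 s (Ioc_subset_Icc_self hs)) hi
      · refine Eventually.of_forall fun s hs => ?_
        rw [uIoc_of_le ht.le] at hs
        refine tendsto_rhs_trunc (K := κ t) hγ hw hφt ?_ (hξx s hs.1.le) hi
        filter_upwards [hint] with n hn
        exact hctrl' hn.1 s (Ioc_subset_Icc_self hs)
    refine tendsto_nhds_unique (hξx t ht.le i hi) ((hlim.const_add (xin i)).congr' ?_)
    filter_upwards [hint] with n hn
    rw [((hreg (φ n)).sub_eq_integral (hγ.trunc hw _) hw ⟨ht.le, hn.1⟩ (hctrl' hn.1) hi).2,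
      hx0 (φ n) i (Finset.mem_Icc.2 ⟨hi, hn.2⟩)]
    ring

end Limit

/-! ### Mass conservation -/

section MassConservation

variable {A : ℝ} {w : ℕ → ℝ} {γ : ℕ → ℕ → ℝ} {K : ℝ}

theorem sum_Icc_one_eq_sum_range (f : ℕ → ℝ) (n : ℕ) :
    ∑ i ∈ Finset.Icc 1 n, f i = ∑ k ∈ Finset.range n, f (k + 1) := by
  induction n with
  | zero => simp
  | succ n ih => rw [Finset.sum_Icc_succ_top (by lia), ih, Finset.sum_range_succ]

theorem Controlled.summable {x : ℕ → ℝ} (h : Controlled w K x) (hw : IsWeight w) :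
    Summable fun k : ℕ => ((k + 1 : ℕ) : ℝ) * w (k + 1) * x (k + 1) :=
  summable_of_sum_range_le (fun k => h.term_nonneg hw (by lia)) fun n => by
    rw [← sum_Icc_one_eq_sum_range (fun i => (i : ℝ) * w i * x i)]
    exact h.sum_le n

theorem Controlled.summable_mul {x : ℕ → ℝ} (h : Controlled w K x) (hw : IsWeight w) :
    Summable fun k : ℕ => ((k + 1 : ℕ) : ℝ) * x (k + 1) :=
  summable_of_sum_range_le
    (fun k => mul_nonneg (Nat.cast_nonneg _) (h.nonneg _ (by lia))) fun n => by
    rw [← sum_Icc_one_eq_sum_range (fun i => (i : ℝ) * x i)]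
    exact h.sum_mul_le hw n

/-- The mass flux out of the first `n` sizes. -/
theorem abs_sum_mul_rhs_le (hγ : IsKernel A w γ) (hw : IsWeight w) {x : ℕ → ℝ}
    (hx : Controlled w K x) {n : ℕ} (hn : 1 ≤ n) :
    |∑ i ∈ Finset.Icc 1 n, (i : ℝ) * rhs γ x i| ≤
      4 * A * K * ((n : ℝ) * w n * x n) + 2 * A * K * K / (1 + n : ℕ) := by
  have hA := hγ.const_pos
  have hK := hx.const_nonneg
  have hn1 : (1 : ℝ) ≤ n := by exact_mod_cast hn
  have hflux : ((n : ℝ) + 1) * flux γ x n ≤ 4 * A * K * ((n : ℝ) * w n * x n) := by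
    calc ((n : ℝ) + 1) * flux γ x n ≤ (2 * n) * (2 * A * K * (w n * x n)) :=
          mul_le_mul (by linarith) (flux_le hγ hw hx.nonneg (hx.sum_mul_le hw) hn)
            (flux_nonneg hγ hx.nonneg n) (by positivity)
      _ = _ := by ring
  have hflux0 : 0 ≤ ((n : ℝ) + 1) * flux γ x n :=
    mul_nonneg (by positivity) (flux_nonneg hγ hx.nonneg n)
  have hterm : ∀ i ∈ Finset.Icc 1 n, 0 ≤ (i : ℝ) * (x i * (tailSum γ x i -
        ∑ k ∈ Finset.range (n + 1 - i), γ i (i + k) * x (i + k))) ∧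
      (i : ℝ) * (x i * (tailSum γ x i -
        ∑ k ∈ Finset.range (n + 1 - i), γ i (i + k) * x (i + k))) ≤
      2 * A * K / (1 + n : ℕ) * ((i : ℝ) * x i) := by
    intro i hi
    obtain ⟨hi1, hin⟩ := Finset.mem_Icc.1 hi
    have h1 := sum_range_le_tailSum hγ hw hx hi1 (n + 1 - i)
    have h2 := tailSum_le hγ hw hx hi1 (n + 1 - i)
    -- Each remainder starts at partner size `n + 1`, whatever `i` is, so one bound serves all rows.
    rw [show i + (n + 1 - i) = 1 + n by lia] at h2
    have hxi : 0 ≤ (i : ℝ) * x i := mul_nonneg (Nat.cast_nonneg i) (hx.nonneg i hi1)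
    rw [← mul_assoc, mul_comm (2 * A * K / _)]
    exact ⟨mul_nonneg hxi (by linarith), mul_le_mul_of_nonneg_left (by linarith) hxi⟩
  have hsum0 := Finset.sum_nonneg fun i hi => (hterm i hi).1
  have hsum1 := Finset.sum_le_sum fun i hi => (hterm i hi).2
  rw [← Finset.mul_sum] at hsum1
  have hsum2 : 2 * A * K / (1 + n : ℕ) * ∑ i ∈ Finset.Icc 1 n, (i : ℝ) * x i ≤
      2 * A * K * K / (1 + n : ℕ) := by
    calc _ ≤ 2 * A * K / (1 + n : ℕ) * K := by
          gcongr
          exact hx.sum_mul_le hw n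
      _ = _ := by ring
  rw [sum_mul_rhs hγ, abs_le]
  constructor <;> linarith

/-- Classical solutions with bounded weighted moment conserve mass. -/
theorem IsRegularOn.tsum_eq (hγ : IsKernel A w γ) (hw : IsWeight w) {T : ℝ} {ξ : ℝ → ℕ → ℝ}
    (h : IsRegularOn γ T ξ) (hK : ∀ t ∈ Icc 0 T, Controlled w K (ξ t)) {t : ℝ}
    (ht : t ∈ Icc 0 T) :
    ∑' k : ℕ, ((k + 1 : ℕ) : ℝ) * ξ t (k + 1) = ∑' k : ℕ, ((k + 1 : ℕ) : ℝ) * ξ 0 (k + 1) := by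
  have hA := hγ.const_pos
  have hT : (0 : ℝ) ∈ Icc 0 T := ⟨le_rfl, ht.1.trans ht.2⟩
  have hK0 := (hK t ht).const_nonneg
  have hKt : ∀ s ∈ Icc 0 t, Controlled w K (ξ s) := fun s hs => hK s ⟨hs.1, hs.2.trans ht.2⟩
  have hcr := fun (i : ℕ) (hi : 1 ≤ i) => h.sub_eq_integral hγ hw ht hKt hi
  have hsumc : ∀ n : ℕ, ContinuousOn
      (fun s => ∑ i ∈ Finset.Icc 1 n, (i : ℝ) * rhs γ (ξ s) i) (Icc 0 t) := fun n =>
    continuousOn_finsetSum _ fun i hi =>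
      continuousOn_const.mul (hcr i (Finset.mem_Icc.1 hi).1).1
  have hmass : ∀ n : ℕ, ∫ s in (0 : ℝ)..t, ∑ i ∈ Finset.Icc 1 n, (i : ℝ) * rhs γ (ξ s) i =
      ∑ k ∈ Finset.range n, ((k + 1 : ℕ) : ℝ) * ξ t (k + 1) -
        ∑ k ∈ Finset.range n, ((k + 1 : ℕ) : ℝ) * ξ 0 (k + 1) := by
    intro n
    rw [intervalIntegral.integral_finsetSum fun i hi => ContinuousOn.intervalIntegrable (by
        rw [uIcc_of_le ht.1]
        exact continuousOn_const.mul (hcr i (Finset.mem_Icc.1 hi).1).1),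
      ← Finset.sum_sub_distrib,
      ← sum_Icc_one_eq_sum_range (fun i => (i : ℝ) * ξ t i - (i : ℝ) * ξ 0 i)]
    refine Finset.sum_congr rfl fun i hi => ?_
    rw [intervalIntegral.integral_const_mul, (hcr i (Finset.mem_Icc.1 hi).1).2, mul_sub]
  have hlim0 : Tendsto (fun n : ℕ => ∫ s in (0 : ℝ)..t,
      ∑ i ∈ Finset.Icc 1 n, (i : ℝ) * rhs γ (ξ s) i) atTop (𝓝 (∫ _ in (0 : ℝ)..t, (0 : ℝ))) := by
    refine intervalIntegral.tendsto_integral_filter_of_dominated_convergence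
      (fun _ => 4 * A * K * K + 2 * A * K * K) (Eventually.of_forall fun n => ?_) ?_ (by simp) ?_
    · rw [uIoc_of_le ht.1]
      exact ((hsumc n).mono Ioc_subset_Icc_self).aestronglyMeasurable measurableSet_Ioc
    · filter_upwards [eventually_ge_atTop 1] with n hn
      refine Eventually.of_forall fun s hs => ?_
      rw [uIoc_of_le ht.1] at hs
      have hs' := hKt s (Ioc_subset_Icc_self hs)
      refine (abs_sum_mul_rhs_le hγ hw hs' hn).trans (add_le_add ?_ ?_)
      · have := hs'.term_le hw hn
        gcongr
      · exact div_le_self (by positivity) (by exact_mod_cast Nat.le_add_right 1 n)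
    · refine Eventually.of_forall fun s hs => ?_
      rw [uIoc_of_le ht.1] at hs
      have hs' := hKt s (Ioc_subset_Icc_self hs)
      -- The flux through size `n` is governed by the general term of the convergent weighted
      -- moment.
      have h1 : Tendsto (fun n : ℕ => (n : ℝ) * w n * ξ s n) atTop (𝓝 0) :=
        (tendsto_add_atTop_iff_nat 1).1 (hs'.summable hw).tendsto_atTop_zero
      have h2 : Tendsto (fun n : ℕ => 4 * A * K * ((n : ℝ) * w n * ξ s n) +
          2 * A * K * K / (1 + n : ℕ)) atTop (𝓝 0) := by
        simpa using (h1.const_mul (4 * A * K)).add (tendsto_const_div_add (2 * A * K * K) 1)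
      refine squeeze_zero_norm' ?_ h2
      filter_upwards [eventually_ge_atTop 1] with n hn
      exact abs_sum_mul_rhs_le hγ hw hs' hn
  rw [intervalIntegral.integral_zero] at hlim0
  have hlim := ((hK t ht).summable_mul hw).hasSum.tendsto_sum_nat.sub
    ((hK 0 hT).summable_mul hw).hasSum.tendsto_sum_nat
  exact sub_eq_zero.1 (tendsto_nhds_unique (hlim.congr fun n => (hmass n).symm) hlim0)

end MassConservation

/-! ### Translation between moments and control, and the main theorem -/

section Moments

variable {δ K : ℝ} {x : ℕ → ℝ}

theorem rpow_one_add_natCast (δ : ℝ) (k : ℕ) :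
    ((k + 1 : ℕ) : ℝ) ^ (1 + δ) = ((k + 1 : ℕ) : ℝ) * ((k + 1 : ℕ) : ℝ) ^ δ := by
  rw [Real.rpow_add (by positivity), Real.rpow_one]

theorem HasMoment.controlled (hx : ∀ i : ℕ, 1 ≤ i → 0 ≤ x i)
    (h : HasMoment (1 + δ) x) (hK : moment (1 + δ) x ≤ K) :
    Controlled (fun i => (i : ℝ) ^ δ) K x where
  nonneg := hx
  sum_le n := by
    rw [sum_Icc_one_eq_sum_range (fun i => (i : ℝ) * (i : ℝ) ^ δ * x i)]
    refine le_trans (le_of_eq ?_) ((h.sum_le_tsum (Finset.range n) fun k _ =>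
      mul_nonneg (by positivity) (hx _ (by lia))).trans hK)
    exact Finset.sum_congr rfl fun k _ => by rw [rpow_one_add_natCast δ]

theorem Controlled.hasMoment (hδ : δ ∈ Icc (0 : ℝ) 1)
    (h : Controlled (fun i => (i : ℝ) ^ δ) K x) : HasMoment (1 + δ) x :=
  (h.summable (isWeight_rpow hδ)).congr fun k => by rw [rpow_one_add_natCast δ]

theorem Controlled.moment_le (h : Controlled (fun i => (i : ℝ) ^ δ) K x) : moment (1 + δ) x ≤ K := by
  refine Real.tsum_le_of_sum_range_le
    (fun k => mul_nonneg (by positivity) (h.nonneg _ (by lia))) fun n => ?_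
  refine le_trans (le_of_eq ?_) (h.sum_le n)
  rw [sum_Icc_one_eq_sum_range (fun i => (i : ℝ) * (i : ℝ) ^ δ * x i)]
  exact Finset.sum_congr rfl fun k _ => by rw [rpow_one_add_natCast δ]

theorem xiNorm_one_eq (hx : ∀ i : ℕ, 1 ≤ i → 0 ≤ x i) :
    xiNorm 1 x = ∑' k : ℕ, ((k + 1 : ℕ) : ℝ) * x (k + 1) :=
  tsum_congr fun k => by rw [Real.rpow_one, abs_of_nonneg (hx _ (by lia))]

theorem Controlled.memXi_one {w : ℕ → ℝ} (hw : IsWeight w) (h : Controlled w K x) : MemXi 1 x :=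
  (h.summable_mul hw).congr fun k => by rw [Real.rpow_one, abs_of_nonneg (h.nonneg _ (by lia))]

theorem LocallyBoundedMoment.exists_controlled {γ : ℕ → ℕ → ℝ} {xin : ℕ → ℝ} {ξ : ℝ → ℕ → ℝ}
    (h : LocallyBoundedMoment (1 + δ) ξ) (hξ : IsSolution γ xin ⊤ ξ)
    {T : ℝ} (hT : 0 < T) :
    ∃ K, ∀ t ∈ Icc 0 T, Controlled (fun i => (i : ℝ) ^ δ) K (ξ t) := by
  obtain ⟨K, hK⟩ := (h T hT).2
  exact ⟨K, fun t ht => ((h T hT).1 t ht).controlled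
    (fun i hi => hξ.nonneg i hi t ht.1 (EReal.coe_lt_top t)) (hK (mem_image_of_mem _ ht))⟩

end Moments

end SafronovDubovskii

theorem mainTheorem2
    (γ : ℕ → ℕ → ℝ)
    (hγ_nonneg : ∀ i j : ℕ, 1 ≤ i → 1 ≤ j → 0 ≤ γ i j)
    (hγ_symm : ∀ i j : ℕ, 1 ≤ i → 1 ≤ j → γ i j = γ j i)
    (δ : ℝ) (hδ : δ ∈ Set.Icc (0 : ℝ) 1)
    (A : ℝ) (hA : 0 < A)
    (hγ_le : ∀ i j : ℕ, 1 ≤ i → 1 ≤ j → γ i j ≤ A * ((i : ℝ) ^ δ + (j : ℝ) ^ δ))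
    (xin : ℕ → ℝ)
    (hxin : SafronovDubovskii.MemXiPos 1 xin)
    (hxin_moment : SafronovDubovskii.HasMoment (1 + δ) xin) :
    (∃ ξ : ℝ → ℕ → ℝ,
      SafronovDubovskii.IsSolution γ xin ⊤ ξ ∧
      SafronovDubovskii.MassConserving xin ξ ∧
      SafronovDubovskii.LocallyBoundedMoment (1 + δ) ξ) ∧
    (∀ ξ η : ℝ → ℕ → ℝ,
      SafronovDubovskii.IsSolution γ xin ⊤ ξ →
      SafronovDubovskii.MassConserving xin ξ →
      SafronovDubovskii.LocallyBoundedMoment (1 + δ) ξ →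
      SafronovDubovskii.IsSolution γ xin ⊤ η →
      SafronovDubovskii.MassConserving xin η →
      SafronovDubovskii.LocallyBoundedMoment (1 + δ) η →
      ∀ t : ℝ, 0 ≤ t → ∀ i : ℕ, 1 ≤ i → ξ t i = η t i) := by
  have hw := SafronovDubovskii.isWeight_rpow hδ
  have hγ : SafronovDubovskii.IsKernel A (fun i => (i : ℝ) ^ δ) γ :=
    ⟨hA, hγ_nonneg, hγ_symm, hγ_le⟩
  constructor
  · have hin := hxin_moment.controlled hxin.2 le_rfl
    have hK := hin.const_nonneg
    obtain ⟨ξ, hξ, hctrl⟩ := SafronovDubovskii.exists_isSolution hγ hw hin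
    set K := SafronovDubovskii.moment (1 + δ) xin
    have hctrlT : ∀ T : ℝ, ∀ t ∈ Icc 0 T, SafronovDubovskii.Controlled (fun i => (i : ℝ) ^ δ)
        (K * Real.exp (6 * A * K * T)) (ξ t) := fun T t ht => (hctrl t ht.1).mono (by
      have := ht.2
      gcongr)
    refine ⟨ξ, hξ, fun t ht => ⟨(hctrl t ht).memXi_one hw, ?_⟩, fun T _ => ⟨fun t ht =>
      (hctrl t ht.1).hasMoment hδ, ⟨K * Real.exp (6 * A * K * T), ?_⟩⟩⟩
    -- The horizon `t + 1` stays positive when `t = 0`.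
    · have hreg := hξ.isRegularOn hγ hw (by linarith : 0 < t + 1) (hctrlT (t + 1))
      rw [SafronovDubovskii.xiNorm_one_eq (hctrl t ht).nonneg,
        SafronovDubovskii.xiNorm_one_eq hxin.2,
        hreg.2.tsum_eq hγ hw (hctrlT (t + 1)) ⟨ht, by linarith⟩]
      exact tsum_congr fun k => by rw [hreg.1 (k + 1) (by lia)]
    · rintro _ ⟨t, ht, rfl⟩
      exact (hctrlT T t ht).moment_le
  · intro ξ η hξ _ hξm hη _ hηm t ht i hi
    have hT : 0 < t + 1 := by linarith
    obtain ⟨K₁, hK₁⟩ := hξm.exists_controlled hξ hT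
    obtain ⟨K₂, hK₂⟩ := hηm.exists_controlled hη hT
    have hξK := fun s hs => (hK₁ s hs).mono (le_max_left K₁ K₂)
    have hηK := fun s hs => (hK₂ s hs).mono (le_max_right K₁ K₂)
    have hξr := hξ.isRegularOn hγ hw hT hξK
    have hηr := hη.isRegularOn hγ hw hT hηK
    exact hξr.2.eq_of_controlled hγ hw hηr.2 hξK hηK
      (fun j hj => (hξr.1 j hj).trans (hηr.1 j hj).symm) t ⟨ht, by linarith⟩ i hi
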